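/- Let $d\ge 3$ and $n\ge 1$ be integers. For each $j\in\{1,\dots,d\}$ and each choice of indices $i_1,\dots,i_{j-1},i_{j+1},\dots,i_d\in[n]$ let $A^{(j)}_{i_1,\dots,i_{j-1},i_{j+1},\dots,i_d}$ be a random variable, all these random variables being independent and uniform on $[0,1]$, and put $$W_{i_1,\dots,i_d}=\sum_{j=1}^d A^{(j)}_{i_1,\dots,i_{j-1},i_{j+1},\dots,i_d}.$$ An assignment is a $(d-1)$-tuple $\sigma=(\sigma_1,\dots,\sigma_{d-1})$ of permutations of $[n]$; its cost is $\sum_{i=1}^n W_{i,\sigma_1(i),\dots,\sigma_{d-1}(i)}$. Let $Z_n$ be the minimum cost of an assignment. For $0\le m\le n$, the algorithm $\mathrm{Greedy}(m)$ starts with $B_2=\dots=B_d=[n]$; for $i=1,\dots,m$ in turn it chooses $(x_2,\dots,x_d)\in B_2\times\dots\times B_d$ minimizing $W_{i,x_2,\dots,x_d}$ (ties being broken arbitrarily), adds the tuple $(i,x_2,\dots,x_d)$ to the partial assignment and removes $x_k$ from $B_k$ for each $k=2,\dots,d$. Finally it completes the partial assignment to an assignment in an arbitrary way. Then there are constants $c_d,C_d>0$,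 depending only on $d$, such that for all $n\ge 1$: (a) $\mathbf{E}(Z_n)\ge c_d\,n^{1/d}$; (b) for every integer $m$ with $|(n-m)-n^{1/(d+1)}|<1$ (that is, $m$ is $n-n^{1/(d+1)}$ rounded up or down), $\mathrm{Greedy}(m)$ always produces an assignment, and, however ties are broken and however the partial assignment is completed (both choices may depend on all the random variables), the expected cost of the assignment produced is at most $C_d\,n^{1/d}$. -/

import Mathlib

open MeasureTheory ProbabilityTheory

namespace MultiAssign

/-- The coordinates `2, …, d` of a `d`-tuple (every coordinate except the first one). -/
abbrev Rest (d : ℕ) : Type := {k : Fin d // k.val ≠ 0}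

/-- The tuple `(i, x₂, …, x_d)`. -/
def mkTuple {d n : ℕ} (i : Fin n) (x : Rest d → Fin n) : Fin d → Fin n :=
  fun k => if h : k.val = 0 then i else x ⟨k, h⟩

/-- Indices of the summands: a coordinate `j`, together with values in `[n]` for all the
coordinates other than `j`. -/
abbrev TableIndex (d n : ℕ) : Type := Σ j : Fin d, ({k : Fin d // k ≠ j} → Fin n)

/-- `W_{i₁,…,i_d} = ∑ⱼ A⁽ʲ⁾_{i₁,…,i_{j-1},i_{j+1},…,i_d}`. -/
noncomputable def weight {d n : ℕ} (A : TableIndex d n → ℝ) (x : Fin d → Fin n) : ℝ :=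
  ∑ j : Fin d, A ⟨j, fun k => x k⟩

/-- An assignment: `d - 1` permutations `σ₁, …, σ_{d-1}` of `[n]`, one for each coordinate
except the first. -/
abbrev Assignment (d n : ℕ) : Type := Rest d → Equiv.Perm (Fin n)

/-- The tuple `(i, σ₁(i), …, σ_{d-1}(i))`. -/
def Assignment.tuple {d n : ℕ} (σ : Assignment d n) (i : Fin n) : Fin d → Fin n :=
  mkTuple i (fun k => σ k i)

/-- The total cost `∑ᵢ W_{i,σ₁(i),…,σ_{d-1}(i)}` of an assignment. -/
noncomputable def cost {d n : ℕ} (W : (Fin d → Fin n) → ℝ) (σ : Assignment d n) : ℝ :=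
  ∑ i : Fin n, W (σ.tuple i)

/-- The minimum cost of an assignment (an infimum over a finite non-empty set). -/
noncomputable def optCost {d n : ℕ} (W : (Fin d → Fin n) → ℝ) : ℝ :=
  ⨅ σ : Assignment d n, cost W σ

/-- `GreedyState W m B T`: the greedy algorithm can be in the state with sets of unused values
`B k` (one for each coordinate except the first) and set of chosen tuples `T` after `m` steps.
The step with first coordinate `i` chooses a tuple `(i, x₂, …, x_d)` of minimum weight
among those whose coordinates `x k` are all unused. Ties are broken arbitrarily. -/
inductive GreedyState {d n : ℕ} (W : (Fin d → Fin n) → ℝ) :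
    ℕ → (Rest d → Finset (Fin n)) → Finset (Fin d → Fin n) → Prop
  | start : GreedyState W 0 (fun _ => Finset.univ) ∅
  | step (i : Fin n) (B : Rest d → Finset (Fin n)) (T : Finset (Fin d → Fin n))
      (x : Rest d → Fin n) (hprev : GreedyState W i.val B T)
      (hmem : ∀ k, x k ∈ B k)
      (hmin : ∀ y : Rest d → Fin n, (∀ k, y k ∈ B k) → W (mkTuple i x) ≤ W (mkTuple i y)) :
      GreedyState W (i.val + 1) (fun k => (B k).erase (x k)) (insert (mkTuple i x) T)

/-- `σ` is a possible output of the greedy algorithm run for `m` steps: it completes the partial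
assignment found in these `m` steps, in an arbitrary way. -/
def IsGreedyOutput {d n : ℕ} (W : (Fin d → Fin n) → ℝ) (m : ℕ) (σ : Assignment d n) : Prop :=
  ∃ B T, GreedyState W m B T ∧ ∀ t ∈ T, ∃ i, σ.tuple i = t

/-- The entries of all the tables are independent uniform `[0,1]` random variables. -/
structure IsUniformModel {d n : ℕ} {Ω : Type*} [MeasurableSpace Ω] (P : Measure Ω)
    (A : TableIndex d n → Ω → ℝ) : Prop where
  indep : iIndepFun A P
  uniform : ∀ e, HasLaw (A e) (volume.restrict (Set.Icc (0 : ℝ) 1)) P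

end MultiAssign

/-!
Uniform variables on `[0, 1]` are realized on a cube with Lebesgue measure; the law of all table
entries in any model is this one.

*Lower bound.* For `d ≥ 2` the cost of a fixed assignment is a sum of `d n` different entries, so
it is at most `s` with probability at most `(e s / (d n)) ^ (d n)` (`cube_real_sum_le`). There are
at most `n ^ (n (d - 1))` assignments, and for `s = d n ^ (1 / d) / (2 e)` the union bound gives a
probability of at most `2 ^ (-d n)` (`cube_real_optCost_le`).

*Upper bound.* In a step with `N` unused values in each coordinate there are `N ^ (d - 1)` possible
tuples, each with a weight at most `t` with probability of order `t ^ d`, so the least weight should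
be of order `t₀ = N ^ (1 / d - 1)`. The sum of these over `N ≤ n` is of order `n ^ (1 / d)`, and the
`n - m` tuples of the completion cost at most `d` each.

The entries of the tables other than the first one used in a step are independent of the past, but
the first table is used in all the steps, and conditioning on the past biases it. This is avoided by
a bound uniform over all boxes of side `N`. With high probability the first table is `WellSpread`:
in each such box, even after the removal of lines covering up to half of it, a quarter of the
expected number of entries are at most `t₀`. The union bound (`cube_real_not_wellSpread_le`) is over
about `exp (d N log n + d N ^ (d - 2))` choices, against the Chernoff bound
`exp (- N ^ (d - 2 + 1 / d) / 8)`; for `d ≥ 3` it succeeds as long as `n ≤ N ^ (d + 1)`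
(`exists_entropy_bound`), which holds for the steps before `n - m ≈ n ^ (1 / (d + 1))`.

In a well-spread table the small entries of a box contain a subset of size of order
`N ^ (d - 1) t₀` with only `O(N t₀)` points on each line (`exists_sparse_subset`). Two tuples share
an entry of the other tables only if they are on a common line, so the second moment method
(`cube_real_no_request_le`) finds a cheap tuple in this subset, with error probabilities which are
summable over the scales `4 ^ k t₀` (`lintegral_box_le`). Integrating first over the fresh entries
(`lintegral_indicator_boxMin_le`) and using that almost surely there are no ties, so that the box
reached is determined by the tables (`ae_sum_reachSet_le`), gives the expected cost of a step.
-/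

namespace MultiAssign

/-! ### Independent uniform variables -/

/-- The uniform distribution on `[0, 1]`. -/
noncomputable def unif : Measure ℝ := volume.restrict (Set.Icc (0 : ℝ) 1)

instance isProbabilityMeasure_unif : IsProbabilityMeasure unif := ⟨by simp [unif]⟩

/-- The uniform distribution on the cube `[0, 1]^ι`. -/
noncomputable abbrev cube (ι : Type*) [Fintype ι] : Measure (ι → ℝ) :=
  Measure.pi fun _ => unif

section Cube

variable {ι : Type*} [Fintype ι]

lemma cube_eq_restrict : cube ι = volume.restrict (Set.univ.pi fun _ => Set.Icc (0 : ℝ) 1) := by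
  rw [volume_pi, Measure.restrict_pi_pi]; rfl

lemma ae_mem_Icc_cube : ∀ᵐ y ∂cube ι, ∀ e, y e ∈ Set.Icc (0 : ℝ) 1 := by
  rw [cube_eq_restrict]
  filter_upwards [ae_restrict_mem (MeasurableSet.univ_pi fun _ => measurableSet_Icc)] with y hy e
  exact hy e (Set.mem_univ e)

lemma unif_Iic {t : ℝ} (h0 : 0 ≤ t) (h1 : t ≤ 1) : unif.real (Set.Iic t) = t := by
  rw [unif, measureReal_restrict_apply measurableSet_Iic]
  have : Set.Iic t ∩ Set.Icc 0 1 = Set.Icc 0 t := by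
    ext x; simp only [Set.mem_inter_iff, Set.mem_Iic, Set.mem_Icc]; constructor
    · rintro ⟨a, b, c⟩; exact ⟨b, a⟩
    · rintro ⟨a, b⟩; exact ⟨b, a, b.trans h1⟩
  rw [this]; simp [h0]

/-- Markov's inequality for a product of independent factors; the choice of `f` gives the
exponential-moment bounds below. -/
lemma cube_real_le_of_prod (E : Finset ι) {f : ℝ → ℝ} (hf0 : ∀ u, 0 ≤ f u)
    (hf : Integrable f unif) {c : ℝ} (hc : 0 < c) :
    (cube ι).real {y | c ≤ ∏ e ∈ E, f (y e)} ≤ (∫ u, f u ∂unif) ^ E.card / c := by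
  classical
  set g : ι → ℝ → ℝ := fun e => if e ∈ E then f else fun _ => 1 with hg
  have hprod : ∀ y : ι → ℝ, ∏ e ∈ E, f (y e) = ∏ e, g e (y e) := by
    intro y
    rw [← Finset.prod_subset (Finset.subset_univ E)]
    · refine Finset.prod_congr rfl fun e he => ?_
      simp [hg, he]
    · intro e _ he; simp [hg, he]
  have hgi : ∀ e, Integrable (g e) unif := by
    intro e; by_cases he : e ∈ E
    · simpa [hg, he] using hf
    · simp only [hg, he, if_false]; exact integrable_const 1
  have hint : ∫ y : ι → ℝ, ∏ e, g e (y e) ∂cube ι = (∫ u, f u ∂unif) ^ E.card := by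
    rw [integral_fintype_prod_eq_prod, ← Finset.prod_subset (Finset.subset_univ E)]
    · rw [Finset.prod_congr rfl (g := fun _ => ∫ u, f u ∂unif), Finset.prod_const]
      intro e he; simp [hg, he]
    · intro e _ he; simp only [hg, he, if_false]; simp
  have hm := mul_meas_ge_le_integral_of_nonneg (μ := cube ι)
    (f := fun y : ι → ℝ => ∏ e, g e (y e)) (Filter.Eventually.of_forall fun y => by
      change 0 ≤ ∏ e, g e (y e)
      rw [← hprod]; exact Finset.prod_nonneg fun e _ => hf0 _)
    (Integrable.fintype_prod hgi) c
  rw [hint] at hm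
  rw [le_div_iff₀ hc, mul_comm]
  simpa only [hprod] using hm

/-- Chernoff's bound: it is unlikely that fewer than a quarter of the expected number of
variables are at most `t`. -/
lemma cube_real_few_le (E : Finset ι) {t : ℝ} (h0 : 0 ≤ t) (h1 : t ≤ 1) :
    (cube ι).real {y | ((E.filter fun e => y e ≤ t).card : ℝ) < E.card * t / 4} ≤
      Real.exp (-(E.card * t / 4)) := by
  obtain ⟨f, hf⟩ : ∃ f : ℝ → ℝ, f = fun u => 1 - (Set.Iic t).indicator (fun _ => (1 / 2 : ℝ)) u :=
    ⟨_, rfl⟩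
  have hind : Integrable ((Set.Iic t).indicator (fun _ => (1 / 2 : ℝ))) unif :=
    (integrable_const _).indicator measurableSet_Iic
  have hf0 : ∀ u, 0 ≤ f u := by
    intro u; simp only [hf, Set.indicator_apply]; split_ifs <;> norm_num
  have hfi : Integrable f unif := by rw [hf]; exact (integrable_const _).sub hind
  have hint : ∫ u, f u ∂unif = 1 - t / 2 := by
    simp only [hf]
    rw [integral_sub (integrable_const _) hind, integral_indicator measurableSet_Iic]
    simp [unif_Iic h0 h1]; ring
  have hpos : (0 : ℝ) < Real.exp (-(E.card * t / 4)) := Real.exp_pos _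
  refine (measureReal_mono (s₂ := {y | Real.exp (-(E.card * t / 4)) ≤ ∏ e ∈ E, f (y e)})
    ?_).trans ((cube_real_le_of_prod E hf0 hfi hpos).trans ?_)
  · intro y hy
    simp only [Set.mem_ofPred_eq] at hy ⊢
    have hp : ∏ e ∈ E, f (y e) = (1 / 2 : ℝ) ^ (E.filter fun e => y e ≤ t).card := by
      rw [← Finset.prod_const, Finset.prod_filter]
      refine Finset.prod_congr rfl fun e _ => ?_
      simp only [hf, Set.indicator_apply, Set.mem_Iic]; split_ifs <;> norm_num
    rw [hp]
    have h2 : Real.exp (-1) ≤ 1 / 2 := by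
      rw [Real.exp_neg, inv_eq_one_div]
      apply one_div_le_one_div_of_le (by norm_num)
      have := Real.add_one_le_exp 1; linarith
    calc Real.exp (-(E.card * t / 4))
        ≤ Real.exp (-((E.filter fun e => y e ≤ t).card : ℝ)) := Real.exp_le_exp.2 (by linarith)
      _ = Real.exp (-1) ^ (E.filter fun e => y e ≤ t).card := by
          rw [← Real.exp_nat_mul]; congr 1; ring
      _ ≤ _ := by gcongr
  · rw [hint, div_le_iff₀ hpos, ← Real.exp_add]
    calc (1 - t / 2) ^ E.card ≤ Real.exp (-(t / 2)) ^ E.card := by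
          gcongr
          · linarith
          · have := Real.add_one_le_exp (-(t / 2)); linarith
      _ = _ := by rw [← Real.exp_nat_mul]; congr 1; ring

/-- A sum of `k` independent uniform variables is at most `s` with probability at most
`(e s / k) ^ k`. -/
lemma cube_real_sum_le (E : Finset ι) (hE : E.Nonempty) {s : ℝ} (hs : 0 < s) :
    (cube ι).real {y | ∑ e ∈ E, y e ≤ s} ≤ (Real.exp 1 * s / E.card) ^ E.card := by
  have hk : (0 : ℝ) < E.card := by exact_mod_cast hE.card_pos
  set l : ℝ := E.card / s with hl
  have hl0 : 0 < l := div_pos hk hs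
  have hcont : Continuous fun u : ℝ => Real.exp (-(l * u)) := by fun_prop
  have hf : Integrable (fun u => Real.exp (-(l * u))) unif :=
    hcont.continuousOn.integrableOn_compact isCompact_Icc
  have hint : ∫ u, Real.exp (-(l * u)) ∂unif ≤ 1 / l := by
    change ∫ u in Set.Icc 0 1, Real.exp (-(l * u)) ≤ 1 / l
    rw [integral_Icc_eq_integral_Ioc, ← intervalIntegral.integral_of_le zero_le_one]
    have : ∀ u ∈ Set.uIcc (0 : ℝ) 1,
        HasDerivAt (fun u => -Real.exp (-(l * u)) / l) (Real.exp (-(l * u))) u := by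
      intro u _
      have h := ((((hasDerivAt_id u).const_mul l).neg).exp.neg).div_const l
      refine h.congr_deriv ?_
      simp only [id, Pi.neg_apply]
      field_simp
    rw [intervalIntegral.integral_eq_sub_of_hasDerivAt this (hcont.intervalIntegrable _ _)]
    have h1 : 0 < Real.exp (-(l * 1)) / l := by positivity
    simp only [mul_zero, neg_zero, Real.exp_zero, neg_div]
    linarith
  have h0 : 0 ≤ ∫ u, Real.exp (-(l * u)) ∂unif := integral_nonneg fun u => (Real.exp_pos _).le
  refine (measureReal_mono (s₂ := {y | Real.exp (-(l * s)) ≤ ∏ e ∈ E, Real.exp (-(l * y e))})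
    ?_).trans ((cube_real_le_of_prod E (fun u => (Real.exp_pos _).le) hf
      (Real.exp_pos (-(l * s)))).trans ?_)
  · intro y hy
    simp only [Set.mem_ofPred_eq] at hy ⊢
    rw [← Real.exp_sum, Real.exp_le_exp, Finset.sum_neg_distrib, ← Finset.mul_sum]
    exact neg_le_neg (mul_le_mul_of_nonneg_left hy hl0.le)
  · rw [Real.exp_neg, div_inv_eq_mul]
    have : Real.exp (l * s) = Real.exp 1 ^ E.card := by
      rw [← Real.exp_nat_mul, hl]; congr 1; field_simp
    rw [this, ← mul_pow]
    gcongr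
    calc (∫ u, Real.exp (-(l * u)) ∂unif) * Real.exp 1 ≤ 1 / l * Real.exp 1 := by gcongr
      _ = _ := by rw [hl]; field_simp

lemma cube_real_forall_le (J : Finset ι) {t : ℝ} (h0 : 0 ≤ t) (h1 : t ≤ 1) :
    (cube ι).real {y | ∀ e ∈ J, y e ≤ t} = t ^ J.card := by
  classical
  have : {y : ι → ℝ | ∀ e ∈ J, y e ≤ t} =
      Set.univ.pi fun e => if e ∈ J then Set.Iic t else Set.univ := by
    ext y; simp only [Set.mem_ofPred_eq, Set.mem_pi, Set.mem_univ, true_implies]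
    refine forall_congr' fun e => ?_
    split_ifs with h <;> simp [h]
  rw [this, measureReal_def, Measure.pi_pi, ENNReal.toReal_prod,
    ← Finset.prod_subset (Finset.subset_univ J)]
  · rw [Finset.prod_congr rfl (g := fun _ => t), Finset.prod_const]
    intro e he
    rw [if_pos he]; exact unif_Iic h0 h1
  · intro e _ he
    rw [if_neg he, measure_univ, ENNReal.toReal_one]

omit [Fintype ι] in
lemma measurableSet_forall_le (J : Finset ι) (t : ℝ) :
    MeasurableSet {y : ι → ℝ | ∀ e ∈ J, y e ≤ t} := by
  have : {y : ι → ℝ | ∀ e ∈ J, y e ≤ t} = ⋂ e ∈ J, {y | y e ≤ t} := by ext; simp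
  rw [this]
  exact Finset.measurableSet_biInter _ fun e _ =>
    measurableSet_le (measurable_pi_apply e) measurable_const

/-- The second moment method. Each `x ∈ S` asks for the `r` variables in `J x` to be at most `t`;
two different requests share at most one variable, and each request shares a variable with at
most `D` others. Then it is unlikely that no request is met. -/
lemma cube_real_no_request_le [DecidableEq ι] {β : Type*} [DecidableEq β] {S : Finset β}
    (hS : S.Nonempty) (J : β → Finset ι) {r D : ℕ} (hr : 1 ≤ r)
    (hJ : ∀ x ∈ S, (J x).card = r)
    (h1 : ∀ x ∈ S, ∀ x' ∈ S, x ≠ x' → (J x ∩ J x').card ≤ 1)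
    (h2 : ∀ x ∈ S, (S.filter fun x' => x' ≠ x ∧ (J x ∩ J x').Nonempty).card ≤ D)
    {t : ℝ} (ht0 : 0 < t) (ht1 : t ≤ 1) :
    (cube ι).real {y | ∀ x ∈ S, ¬ ∀ e ∈ J x, y e ≤ t} ≤
      1 / (S.card * t ^ r) + D / (S.card * t) := by
  have hs : (0 : ℝ) < S.card := by exact_mod_cast hS.card_pos
  set A : β → Set (ι → ℝ) := fun x => {y | ∀ e ∈ J x, y e ≤ t} with hA
  have hAm : ∀ x, MeasurableSet (A x) := fun x => measurableSet_forall_le _ _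
  set M : ℝ := S.card * t ^ r with hM
  have hMpos : 0 < M := by positivity
  set X : (ι → ℝ) → ℝ := fun y => ∑ x ∈ S, (A x).indicator 1 y with hX
  have hXX : ∀ y, X y * X y = ∑ x ∈ S, ∑ x' ∈ S, (A x ∩ A x').indicator 1 y := by
    intro y
    simp only [hX, Finset.sum_mul_sum]
    refine Finset.sum_congr rfl fun x _ => Finset.sum_congr rfl fun x' _ => ?_
    rw [Set.inter_indicator_one]; rfl
  have hi1 : ∀ B : Set (ι → ℝ), MeasurableSet B →
      Integrable (B.indicator (1 : (ι → ℝ) → ℝ)) (cube ι) := fun B hB =>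
    (integrable_const (1 : ℝ)).indicator hB
  have hXi : Integrable X (cube ι) := integrable_finsetSum _ fun x _ => hi1 _ (hAm x)
  have hXXi : Integrable (fun y => X y * X y) (cube ι) := by
    simp only [hXX]
    exact integrable_finsetSum _ fun x _ => integrable_finsetSum _ fun x' _ =>
      hi1 _ ((hAm x).inter (hAm x'))
  have hEX : ∫ y, X y ∂cube ι = M := by
    simp only [hX]
    rw [integral_finsetSum _ fun x _ => hi1 _ (hAm x)]
    rw [Finset.sum_congr rfl (g := fun _ => t ^ r)]
    · simp [hM]
    · intro x hx
      rw [integral_indicator_one (hAm x), cube_real_forall_le _ ht0.le ht1, hJ x hx]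
  have hEXX : ∫ y, X y * X y ∂cube ι ≤
      S.card * (t ^ r + D * t ^ (2 * r - 1) + S.card * t ^ (2 * r)) := by
    simp only [hXX]
    rw [integral_finsetSum _ fun x _ => integrable_finsetSum _ fun x' _ =>
      hi1 _ ((hAm x).inter (hAm x'))]
    rw [← nsmul_eq_mul]
    refine Finset.sum_le_card_nsmul _ _ _ fun x hx => ?_
    rw [integral_finsetSum _ fun x' _ => hi1 _ ((hAm x).inter (hAm x'))]
    have key : ∀ x' ∈ S, ∫ y, (A x ∩ A x').indicator (1 : (ι → ℝ) → ℝ) y ∂cube ι ≤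
        (if x' = x then t ^ r else 0) +
          (if x' ≠ x ∧ (J x ∩ J x').Nonempty then t ^ (2 * r - 1) else 0) + t ^ (2 * r) := by
      intro x' hx'
      have hU : A x ∩ A x' = {y | ∀ e ∈ J x ∪ J x', y e ≤ t} := by
        ext y; simp only [hA, Set.mem_inter_iff, Set.mem_ofPred_eq, Finset.mem_union, or_imp,
          forall_and]
      rw [integral_indicator_one ((hAm x).inter (hAm x')), hU,
        cube_real_forall_le _ ht0.le ht1]
      have hc := Finset.card_union_add_card_inter (J x) (J x')
      rw [hJ x hx, hJ x' hx'] at hc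
      have hp : 0 ≤ t ^ (2 * r) := by positivity
      by_cases hxx : x' = x
      · subst hxx
        simp only [Finset.union_self, hJ x' hx', ne_eq, not_true, false_and, if_true, if_false]
        linarith
      · by_cases hn : (J x ∩ J x').Nonempty
        · have h3 := h1 x hx x' hx' (Ne.symm hxx)
          have h4 := hn.card_pos
          rw [show (J x ∪ J x').card = 2 * r - 1 by omega]
          simp [hxx, hn, hp]
        · rw [Finset.not_nonempty_iff_eq_empty] at hn
          rw [hn, Finset.card_empty] at hc
          rw [show (J x ∪ J x').card = 2 * r by omega]
          simp [hxx, hn]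
    refine (Finset.sum_le_sum key).trans ?_
    rw [Finset.sum_add_distrib, Finset.sum_add_distrib, Finset.sum_ite_eq' S x, if_pos hx,
      ← Finset.sum_filter, Finset.sum_const, Finset.sum_const, nsmul_eq_mul, nsmul_eq_mul]
    gcongr
    exact_mod_cast h2 x hx
  have hmk := mul_meas_ge_le_integral_of_nonneg (μ := cube ι)
    (f := fun y => (M - X y) * (M - X y))
    (Filter.Eventually.of_forall fun y => mul_self_nonneg _)
    (by
      have : (fun y => (M - X y) * (M - X y)) = fun y => M * M - 2 * M * X y + X y * X y := by
        ext y; ring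
      rw [this]
      exact ((integrable_const _).sub (hXi.const_mul _)).add hXXi) (M * M)
  have hE : ∫ y, (M - X y) * (M - X y) ∂cube ι = ∫ y, X y * X y ∂cube ι - M * M := by
    have : (fun y => (M - X y) * (M - X y)) = fun y => M * M - 2 * M * X y + X y * X y := by
      ext y; ring
    have h1 : Integrable (fun y => M * M - 2 * M * X y) (cube ι) :=
      (integrable_const _).sub (hXi.const_mul _)
    rw [this, integral_add h1 hXXi, integral_sub (integrable_const _) (hXi.const_mul _),
      integral_const_mul (2 * M), hEX]
    simp; ring
  rw [hE] at hmk
  have hsub : (cube ι).real {y | ∀ x ∈ S, ¬ ∀ e ∈ J x, y e ≤ t} ≤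
      (cube ι).real {y | M * M ≤ (M - X y) * (M - X y)} := by
    refine measureReal_mono ?_
    intro y hy
    have : X y = 0 := Finset.sum_eq_zero fun x hx => by
      simp only [Set.indicator_apply, hA, Set.mem_ofPred_eq]
      rw [if_neg (hy x hx)]
    simp [this]
  refine hsub.trans ?_
  have hfin : M * M * (cube ι).real {y | M * M ≤ (M - X y) * (M - X y)} ≤
      S.card * (t ^ r + D * t ^ (2 * r - 1)) := by
    refine hmk.trans ?_
    have : (S.card : ℝ) * (S.card * t ^ (2 * r)) = M * M := by rw [hM]; ring
    linarith
  rw [← le_div_iff₀' (by positivity)] at hfin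
  refine hfin.trans (le_of_eq ?_)
  obtain ⟨q, rfl⟩ : ∃ q, r = q + 1 := ⟨r - 1, by omega⟩
  rw [hM, show 2 * (q + 1) - 1 = 2 * q + 1 by omega]
  field_simp
  ring

/-- A non-trivial linear relation between independent uniform variables almost surely fails. -/
lemma cube_ae_linear_ne_zero (φ : (ι → ℝ) →ₗ[ℝ] ℝ) (hφ : φ ≠ 0) : ∀ᵐ y ∂cube ι, φ y ≠ 0 := by
  have h : volume (LinearMap.ker φ : Set (ι → ℝ)) = 0 :=
    Measure.addHaar_submodule _ _ (by rwa [Ne, LinearMap.ker_eq_top])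
  rw [cube_eq_restrict]
  refine ae_restrict_of_ae ?_
  rw [ae_iff]
  refine measure_mono_null (fun y hy => ?_) h
  simpa using hy

end Cube

/-! ### Sparse subsets of boxes -/

section Lines

variable {κ α : Type*} [Fintype κ] [DecidableEq κ] [DecidableEq α]

/-- The line in direction `k` through `y`, encoded by the coordinates of `y` other than `k`. -/
def offLine (k : κ) (y : κ → α) : {l : κ // l ≠ k} → α := fun l => y l

/-- The points of the box `∏ B k` lying on none of the lines in `L`. -/
def boxMinusLines (B : κ → Finset α) (L : ∀ k : κ, Finset ({l : κ // l ≠ k} → α)) :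
    Finset (κ → α) :=
  (Fintype.piFinset B).filter fun y => ∀ k, offLine k y ∉ L k

omit [Fintype κ] [DecidableEq κ] [DecidableEq α] in
lemma offLine_eq_iff {k : κ} {y y' : κ → α} :
    offLine k y = offLine k y' ↔ ∀ l, l ≠ k → y l = y' l :=
  ⟨fun h l hl => congrFun h ⟨l, hl⟩, fun h => funext fun l => h l l.2⟩

lemma card_filter_offLine_mem_le (B : κ → Finset α) {N : ℕ} (hB : ∀ k, (B k).card = N) (k : κ)
    (L : Finset ({l : κ // l ≠ k} → α)) :
    ((Fintype.piFinset B).filter fun y => offLine k y ∈ L).card ≤ L.card * N := by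
  rw [← hB k, ← Finset.card_product]
  refine Finset.card_le_card_of_injOn (fun y => (offLine k y, y k)) ?_ ?_
  · intro y hy
    simp only [Finset.coe_filter, Fintype.mem_piFinset, Set.mem_ofPred_eq] at hy
    simp only [Finset.coe_product, Set.mem_prod, Finset.mem_coe]
    exact ⟨hy.2, hy.1 k⟩
  · intro y _ y' _ h
    simp only [Prod.mk.injEq] at h
    funext l
    by_cases hl : l = k
    · subst hl; exact h.2
    · exact offLine_eq_iff.1 h.1 l hl

lemma card_mul_le_card_of_rich_lines (S : Finset (κ → α)) (D : ℕ) (k : κ) :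
    ((S.filter fun y => D ≤ (S.filter fun y' => offLine k y' = offLine k y).card).image
      (offLine k)).card * D ≤ S.card := by
  set L := (S.filter fun y => D ≤ (S.filter fun y' => offLine k y' = offLine k y).card).image
    (offLine k) with hL
  calc L.card * D = ∑ _p ∈ L, D := by simp
    _ ≤ ∑ p ∈ L, (S.filter fun y' => offLine k y' = p).card := by
        refine Finset.sum_le_sum fun p hp => ?_
        obtain ⟨y, hy, rfl⟩ := Finset.mem_image.1 hp
        exact (Finset.mem_filter.1 hy).2
    _ = (L.biUnion fun p => S.filter fun y' => offLine k y' = p).card := by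
        rw [Finset.card_biUnion]
        intro p _ p' _ hpp
        rw [Function.onFun, Finset.disjoint_left]
        intro y hy hy'
        exact hpp ((Finset.mem_filter.1 hy).2.symm.trans (Finset.mem_filter.1 hy').2)
    _ ≤ S.card := Finset.card_le_card (Finset.biUnion_subset.2 fun p _ => Finset.filter_subset _ _)

/-- If every set obtained from a box by removing lines, at most half of the box, contains at
least `q` points of `S`, then `S` has at least `q` points in the box with at most `D` on each line.
A maximal subset with at most `D` points on each line works: the lines on which it is full cover
at most half of the box, and off these lines it contains all of `S`. -/
lemma exists_sparse_subset (S : Finset (κ → α)) (B : κ → Finset α) {N D : ℕ}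
    (hB : ∀ k, (B k).card = N) (hD : 1 ≤ D) {q : ℝ}
    (hq : 2 * Fintype.card κ * q * N ≤ D * (N : ℝ) ^ Fintype.card κ)
    (h : ∀ L : ∀ k : κ, Finset ({l : κ // l ≠ k} → α),
      (∀ k, L k ⊆ Fintype.piFinset fun l : {l : κ // l ≠ k} => B l) →
      (N : ℝ) ^ Fintype.card κ / 2 ≤ (boxMinusLines B L).card →
      q ≤ ((boxMinusLines B L).filter fun y => y ∈ S).card) :
    ∃ T : Finset (κ → α), T ⊆ S ∧ T ⊆ Fintype.piFinset B ∧
      (∀ k, ∀ y ∈ T, (T.filter fun y' => offLine k y' = offLine k y).card ≤ D) ∧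
      q ≤ T.card := by
  classical
  set F := (S ∩ Fintype.piFinset B).powerset.filter fun T =>
    ∀ k, ∀ y ∈ T, (T.filter fun y' => offLine k y' = offLine k y).card ≤ D with hF
  have hne : F.Nonempty := ⟨∅, Finset.mem_filter.2 ⟨Finset.empty_mem_powerset _, by simp⟩⟩
  obtain ⟨T, hTF, hmax⟩ := F.exists_max_image Finset.card hne
  have hT := Finset.mem_filter.1 hTF
  have hTsub := Finset.mem_powerset.1 hT.1
  refine ⟨T, hTsub.trans Finset.inter_subset_left, hTsub.trans Finset.inter_subset_right,
    hT.2, ?_⟩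
  by_contra! hlt
  set L : ∀ k : κ, Finset ({l : κ // l ≠ k} → α) := fun k =>
    (T.filter fun y => D ≤ (T.filter fun y' => offLine k y' = offLine k y).card).image
      (offLine k) with hL
  have hLcard : ∀ k, (L k).card * D ≤ T.card := fun k => card_mul_le_card_of_rich_lines T D k
  have hLsub : ∀ k, L k ⊆ Fintype.piFinset fun l : {l : κ // l ≠ k} => B l := by
    intro k p hp
    obtain ⟨y, hy, rfl⟩ := Finset.mem_image.1 hp
    have := Fintype.mem_piFinset.1
      (Finset.mem_inter.1 (hTsub (Finset.mem_filter.1 hy).1)).2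
    exact Fintype.mem_piFinset.2 fun l => this l
  have hD0 : (0 : ℝ) < D := by exact_mod_cast hD
  have hcov : (Fintype.piFinset B).card ≤ (boxMinusLines B L).card + ∑ k, (L k).card * N := by
    calc (Fintype.piFinset B).card
        ≤ (boxMinusLines B L ∪ Finset.univ.biUnion fun k =>
            (Fintype.piFinset B).filter fun y => offLine k y ∈ L k).card := by
          refine Finset.card_le_card fun y hy => ?_
          by_cases hyL : ∀ k, offLine k y ∉ L k
          · exact Finset.mem_union_left _ (Finset.mem_filter.2 ⟨hy, hyL⟩)
          · push Not at hyL
            obtain ⟨k, hk⟩ := hyL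
            exact Finset.mem_union_right _
              (Finset.mem_biUnion.2 ⟨k, Finset.mem_univ k, Finset.mem_filter.2 ⟨hy, hk⟩⟩)
      _ ≤ _ := (Finset.card_union_le _ _).trans (Nat.add_le_add_left
          (Finset.card_biUnion_le.trans
            (Finset.sum_le_sum fun k _ => card_filter_offLine_mem_le B hB k (L k))) _)
  have hpi : (Fintype.piFinset B).card = N ^ Fintype.card κ := by
    rw [Fintype.card_piFinset]; simp [hB]
  have hhalf : (N : ℝ) ^ Fintype.card κ / 2 ≤ (boxMinusLines B L).card := by
    have h1 : (N : ℝ) ^ Fintype.card κ ≤ (boxMinusLines B L).card + ∑ k, (L k).card * (N : ℝ) := by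
      rw [hpi] at hcov; exact_mod_cast hcov
    have h2 : ∑ k, ((L k).card : ℝ) * N ≤ Fintype.card κ * (q / D * N) := by
      rw [← Finset.card_univ, ← nsmul_eq_mul]
      refine Finset.sum_le_card_nsmul _ _ _ fun k _ => ?_
      gcongr
      rw [le_div_iff₀ hD0]
      have : ((L k).card : ℝ) * D ≤ T.card := by exact_mod_cast hLcard k
      linarith
    have h3 : Fintype.card κ * (q / D * N) ≤ (N : ℝ) ^ Fintype.card κ / 2 := by
      rw [show Fintype.card κ * (q / D * N) = (Fintype.card κ * q * N) / D by ring,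
        div_le_iff₀ hD0]
      linarith
    linarith
  have hq' := h L hLsub hhalf
  have hsub : ((boxMinusLines B L).filter fun y => y ∈ S) ⊆ T := by
    intro y hy
    obtain ⟨hyE, hyS⟩ := Finset.mem_filter.1 hy
    obtain ⟨hyB, hyL⟩ := Finset.mem_filter.1 hyE
    by_contra hyT
    have hnew : ∀ k, (T.filter fun y' => offLine k y' = offLine k y).card < D := by
      intro k
      by_contra! hDle
      have hpos : 0 < (T.filter fun y' => offLine k y' = offLine k y).card := by omega
      obtain ⟨z, hz⟩ := Finset.card_pos.1 hpos
      obtain ⟨hzT, hzy⟩ := Finset.mem_filter.1 hz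
      refine hyL k (Finset.mem_image.2 ⟨z, Finset.mem_filter.2 ⟨hzT, ?_⟩, hzy⟩)
      rw [hzy]; exact hDle
    have hins : insert y T ∈ F := by
      refine Finset.mem_filter.2 ⟨Finset.mem_powerset.2 (Finset.insert_subset
        (Finset.mem_inter.2 ⟨hyS, hyB⟩) hTsub), fun k z hz => ?_⟩
      rw [Finset.filter_insert]
      split_ifs with hzy
      · rw [← hzy]
        exact (Finset.card_insert_le _ _).trans (hnew k)
      · rcases Finset.mem_insert.1 hz with rfl | hzT
        · exact absurd rfl hzy
        · exact hT.2 k z hzT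
    have := hmax _ hins
    rw [Finset.card_insert_of_notMem hyT] at this
    omega
  have : (((boxMinusLines B L).filter fun y => y ∈ S).card : ℝ) ≤ T.card := by
    exact_mod_cast Finset.card_le_card hsub
  linarith

/-- The table `a` has no large depleted region: each box of side `N` from which lines covering at
most half of it are removed contains at least a quarter of the expected number of entries at
most `t`. -/
def WellSpread [Fintype α] (N : ℕ) (t : ℝ) (a : (κ → α) → ℝ) : Prop :=
  ∀ B : κ → Finset α, (∀ k, (B k).card = N) →
    ∀ L : ∀ k : κ, Finset ({l : κ // l ≠ k} → α),
      (∀ k, L k ⊆ Fintype.piFinset fun l : {l : κ // l ≠ k} => B l) →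
      (N : ℝ) ^ Fintype.card κ / 2 ≤ (boxMinusLines B L).card →
      ((boxMinusLines B L).card : ℝ) * t / 4 ≤ ((boxMinusLines B L).filter fun y => a y ≤ t).card

/-- The pairs of a box of side `N` and a choice of lines inside it. -/
def boxLines [Fintype α] (κ : Type*) [Fintype κ] [DecidableEq κ] (N : ℕ) :
    Finset (Σ _ : κ → Finset α, ∀ k : κ, Finset ({l : κ // l ≠ k} → α)) :=
  (Fintype.piFinset fun _ => Finset.univ.powersetCard N).sigma fun B =>
    Fintype.piFinset fun k => (Fintype.piFinset fun l : {l : κ // l ≠ k} => B l).powerset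

omit [DecidableEq α] in
lemma card_boxLines_le [Fintype α] (N : ℕ) :
    (boxLines (α := α) κ N).card ≤ (Fintype.card α ^ N) ^ Fintype.card κ *
      (2 ^ N ^ (Fintype.card κ - 1)) ^ Fintype.card κ := by
  rw [boxLines, Finset.card_sigma]
  have h : ∀ B ∈ (Fintype.piFinset fun _ : κ => (Finset.univ : Finset α).powersetCard N),
      (Fintype.piFinset fun k : κ =>
        (Fintype.piFinset fun l : {l : κ // l ≠ k} => B l).powerset).card ≤
        (2 ^ N ^ (Fintype.card κ - 1)) ^ Fintype.card κ := by
    intro B hB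
    have hBk : ∀ k, (B k).card = N := fun k =>
      (Finset.mem_powersetCard.1 (Fintype.mem_piFinset.1 hB k)).2
    rw [Fintype.card_piFinset]
    simp [hBk, Fintype.card_subtype_compl]
  refine (Finset.sum_le_card_nsmul _ _ _ h).trans ?_
  rw [smul_eq_mul]
  refine Nat.mul_le_mul_right _ ?_
  rw [Fintype.card_piFinset]
  simp only [Finset.card_powersetCard, Finset.card_univ, Finset.prod_const]
  exact Nat.pow_le_pow_left (Nat.choose_le_pow _ _) _

lemma measurableSet_wellSpread [Fintype α] {ι : Type*} (N : ℕ) (t : ℝ) (e : (κ → α) → ι) :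
    MeasurableSet {a : ι → ℝ | WellSpread N t fun y => a (e y)} := by
  have hm : ∀ E : Finset (κ → α), Measurable fun a : ι → ℝ =>
      ((E.filter fun y => a (e y) ≤ t).card : ℝ) := by
    intro E
    simp only [Finset.card_filter, Nat.cast_sum, Nat.cast_ite, Nat.cast_one, Nat.cast_zero]
    exact Finset.measurable_sum _ fun y _ =>
      Measurable.ite (measurableSet_le (measurable_pi_apply _) measurable_const)
        measurable_const measurable_const
  simp only [WellSpread, Set.ofPred_forall]
  exact MeasurableSet.iInter fun B => MeasurableSet.iInter fun _ => MeasurableSet.iInter fun L =>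
    MeasurableSet.iInter fun _ => MeasurableSet.iInter fun _ =>
      measurableSet_le measurable_const (hm _)

/-- A union bound over all boxes and all choices of lines. -/
lemma cube_real_not_wellSpread_le [Fintype α] {ι : Type*} [Fintype ι] (N : ℕ) {t : ℝ}
    (h0 : 0 ≤ t) (h1 : t ≤ 1) {e : (κ → α) → ι} (he : Function.Injective e) :
    (cube ι).real {a | ¬ WellSpread N t fun y => a (e y)} ≤
      ((Fintype.card α : ℝ) ^ N) ^ Fintype.card κ *
        (2 ^ N ^ (Fintype.card κ - 1)) ^ Fintype.card κ *
        Real.exp (-((N : ℝ) ^ Fintype.card κ * t / 8)) := by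
  classical
  set R := (boxLines (α := α) κ N).filter fun p =>
    (N : ℝ) ^ Fintype.card κ / 2 ≤ (boxMinusLines p.1 p.2).card with hR
  have hsub : {a : ι → ℝ | ¬ WellSpread N t fun y => a (e y)} ⊆
      ⋃ p ∈ R, {a | ((((boxMinusLines p.1 p.2).image e).filter fun i => a i ≤ t).card : ℝ) <
        ((boxMinusLines p.1 p.2).image e).card * t / 4} := by
    intro a ha
    simp only [WellSpread, Set.mem_ofPred_eq, not_forall, not_le] at ha
    obtain ⟨B, hB, L, hL, hhalf, hlt⟩ := ha
    refine Set.mem_biUnion (x := ⟨B, L⟩) ?_ ?_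
    · refine Finset.mem_filter.2 ⟨Finset.mem_sigma.2 ⟨Fintype.mem_piFinset.2 fun k =>
        Finset.mem_powersetCard.2 ⟨Finset.subset_univ _, hB k⟩, Fintype.mem_piFinset.2 fun k =>
        Finset.mem_powerset.2 (hL k)⟩, hhalf⟩
    · simp only [Set.mem_ofPred_eq]
      rw [Finset.filter_image, Finset.card_image_of_injective _ he,
        Finset.card_image_of_injective _ he]
      exact hlt
  refine (measureReal_mono hsub (measure_ne_top _ _)).trans
    ((measureReal_biUnion_finset_le _ _).trans ?_)
  have hp : ∀ p ∈ R, (cube ι).real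
      {a | ((((boxMinusLines p.1 p.2).image e).filter fun i => a i ≤ t).card : ℝ) <
        ((boxMinusLines p.1 p.2).image e).card * t / 4} ≤
      Real.exp (-((N : ℝ) ^ Fintype.card κ * t / 8)) := by
    intro p hp
    refine (cube_real_few_le _ h0 h1).trans (Real.exp_le_exp.2 ?_)
    rw [Finset.card_image_of_injective _ he]
    have := mul_le_mul_of_nonneg_right (Finset.mem_filter.1 hp).2 h0
    linarith
  refine (Finset.sum_le_card_nsmul _ _ _ hp).trans ?_
  rw [nsmul_eq_mul]
  gcongr
  exact_mod_cast (Finset.card_filter_le _ _).trans (card_boxLines_le N)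

end Lines

/-! ### The cheapest tuple in a box -/

section Row

/-- The inequalities satisfied by the scale `t = N ^ (-r / (r + 1))`. -/
lemma scale_ineqs {N r : ℕ} (hr : 2 ≤ r) (hN : 1 ≤ N) {t : ℝ} (ht : 0 < t)
    (h : (N : ℝ) ^ r * t ^ (r + 1) = 1) :
    t ≤ 1 ∧ 1 ≤ N * t ∧ ((N : ℝ) * ((N : ℝ) ^ r)⁻¹) ^ 2 ≤ t ^ 3 := by
  have hN1 : (1 : ℝ) ≤ N := by exact_mod_cast hN
  have hNr : (1 : ℝ) ≤ (N : ℝ) ^ r := one_le_pow₀ hN1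
  refine ⟨?_, ?_, ?_⟩
  · by_contra! h1
    have := one_lt_pow₀ h1 (Nat.add_one_ne_zero r)
    nlinarith
  · rw [← one_le_pow_iff_of_nonneg (by positivity) (Nat.succ_ne_zero r), mul_pow, pow_succ,
      mul_right_comm, h]
    simpa using hN1
  · -- the `(r + 1)`-th powers differ by a factor `N ^ (2 r ^ 2 - 3 r - 2)`
    refine le_of_pow_le_pow_left₀ (Nat.succ_ne_zero r) (by positivity) ?_
    have ht' : t ^ (r + 1) = ((N : ℝ) ^ r)⁻¹ := eq_inv_of_mul_eq_one_right h
    have e : (t ^ 3) ^ (r + 1) = (((N : ℝ) ^ r)⁻¹) ^ 3 := by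
      rw [← ht', ← pow_mul, ← pow_mul, mul_comm]
    rw [e]
    have hNr0 : (0 : ℝ) < (N : ℝ) ^ r := by positivity
    rw [← div_eq_mul_inv, div_pow, div_pow, inv_pow, div_le_iff₀ (by positivity),
      inv_mul_eq_div, le_div_iff₀ (by positivity)]
    simp only [← pow_mul, ← pow_add]
    refine pow_le_pow_right₀ hN1 ?_
    nlinarith

variable {κ α ι : Type*} [Fintype κ] [DecidableEq κ] [DecidableEq α] [Fintype α]
  [Fintype ι]

omit [Fintype α] in
/-- A family of tables is indexed by `κ`, and `e k y` is the entry of the `k`-th table used by the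
tuple `y`; it is determined by the line in direction `k` through `y`. Two tuples therefore share
at most one entry, and only if they are on a common line, so that the second moment method applies
to sets `T` with few points on each line. -/
lemma cube_real_no_cheap_le (e : κ → (κ → α) → ι)
    (he : ∀ k k' y y', e k y = e k' y' ↔ k = k' ∧ offLine k y = offLine k y')
    (hκ : 1 ≤ Fintype.card κ) {T : Finset (κ → α)} (hT : T.Nonempty) {D : ℕ}
    (hD : ∀ k, ∀ y ∈ T, (T.filter fun y' => offLine k y' = offLine k y).card ≤ D)
    {t : ℝ} (ht0 : 0 < t) (ht1 : t ≤ 1) :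
    (cube ι).real {u | ∀ y ∈ T, ¬ ∀ k, u (e k y) ≤ t} ≤
      1 / (T.card * t ^ Fintype.card κ) + (Fintype.card κ * D : ℕ) / (T.card * t) := by
  classical
  have hset : {u : ι → ℝ | ∀ y ∈ T, ¬ ∀ k, u (e k y) ≤ t} =
      {u | ∀ y ∈ T, ¬ ∀ i ∈ Finset.univ.image fun k => e k y, u i ≤ t} := by
    ext u; simp
  have hshare : ∀ y y' : κ → α, ∀ i ∈ (Finset.univ.image fun k => e k y) ∩
      (Finset.univ.image fun k => e k y'), ∃ k, i = e k y ∧ offLine k y = offLine k y' := by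
    intro y y' i hi
    obtain ⟨h1, h2⟩ := Finset.mem_inter.1 hi
    obtain ⟨k, -, rfl⟩ := Finset.mem_image.1 h1
    obtain ⟨k', -, hk'⟩ := Finset.mem_image.1 h2
    obtain ⟨rfl, h⟩ := (he _ _ _ _).1 hk'
    exact ⟨k', rfl, h.symm⟩
  rw [hset]
  refine cube_real_no_request_le hT _ hκ ?_ ?_ ?_ ht0 ht1
  · intro y _
    rw [Finset.card_image_of_injective _ fun k k' h => ((he _ _ _ _).1 h).1, Finset.card_univ]
  · intro y _ y' _ hne
    rw [Finset.card_le_one]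
    intro i hi i' hi'
    obtain ⟨k, rfl, hk⟩ := hshare y y' i hi
    obtain ⟨k', rfl, hk'⟩ := hshare y y' i' hi'
    by_cases hkk : k = k'
    · rw [hkk]
    · refine absurd (funext fun l => ?_) hne
      by_cases hl : l = k
      · exact offLine_eq_iff.1 hk' l (hl ▸ hkk)
      · exact offLine_eq_iff.1 hk l hl
  · intro y hy
    calc _ ≤ (Finset.univ.biUnion fun k => T.filter fun y' => offLine k y' = offLine k y).card := by
          refine Finset.card_le_card fun y' hy' => ?_
          obtain ⟨hy'T, -, i, hi⟩ := Finset.mem_filter.1 hy'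
          obtain ⟨k, -, hk⟩ := hshare y y' i hi
          exact Finset.mem_biUnion.2 ⟨k, Finset.mem_univ k, Finset.mem_filter.2 ⟨hy'T, hk.symm⟩⟩
      _ ≤ _ := Finset.card_biUnion_le_card_mul _ _ _ fun k _ => hD k y hy

/-- If the probability of `F k` is at most `K * 8⁻ᵏ` for each scale `4ᵏ`, the expectation of
`∑ 4ᵏ 1_{F k}` is bounded. -/
lemma integral_scales_le {F : ℕ → Set (ι → ℝ)} {K : ℝ} (M : ℕ) (hFm : ∀ k, MeasurableSet (F k))
    (hF : ∀ k < M, (cube ι).real (F k) ≤ K * (1 / 8) ^ k) (hK : 0 ≤ K) :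
    ∫ u, ∑ k ∈ Finset.range M, (F k).indicator (fun _ => (4 : ℝ) ^ k) u ∂cube ι ≤ 2 * K := by
  rw [integral_finsetSum _ fun k _ => (integrable_const _).indicator (hFm k)]
  calc _ ≤ ∑ k ∈ Finset.range M, K * (1 / 2 : ℝ) ^ k := by
        refine Finset.sum_le_sum fun k hk => ?_
        rw [integral_indicator_const _ (hFm k), smul_eq_mul]
        calc _ ≤ K * (1 / 8) ^ k * 4 ^ k := by
              gcongr; exact hF k (Finset.mem_range.1 hk)
          _ = K * (1 / 2 : ℝ) ^ k := by rw [mul_assoc, ← mul_pow]; norm_num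
    _ = K * ∑ k ∈ Finset.range M, (1 / 2 : ℝ) ^ k := by rw [Finset.mul_sum]
    _ ≤ K * 2 := by gcongr; exact sum_geometric_two_le M
    _ = 2 * K := mul_comm _ _

/-- In a well-spread table, a box of side `N` contains a tuple of cost `O(N ^ (-r / (r + 1)))` in
expectation over independent entries of the other tables. The tuple is sought in a sparse
subset of the small entries of the well-spread table, by the second moment method at each of the
scales `t * 4 ^ k`. -/
lemma lintegral_box_le (e : κ → (κ → α) → ι)
    (he : ∀ k k' y y', e k y = e k' y' ↔ k = k' ∧ offLine k y = offLine k y')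
    {r N : ℕ} (hκ : Fintype.card κ = r) (hr : 2 ≤ r) (hN : 1 ≤ N) {t : ℝ} (ht : 0 < t)
    (hNt : (N : ℝ) ^ r * t ^ (r + 1) = 1) {a : (κ → α) → ℝ} (ha : WellSpread N t a)
    {B : κ → Finset α} (hB : ∀ k, (B k).card = N) :
    ∫⁻ u, ⨅ y ∈ Fintype.piFinset B, ENNReal.ofReal (a y + ∑ k, u (e k y)) ∂cube ι ≤
      ENNReal.ofReal ((1 + r + 6 * r * (8 + 16 * r ^ 2)) * t) := by
  obtain ⟨ht1, hNt1, hNt3⟩ := scale_ineqs hr hN ht hNt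
  have hN0 : (0 : ℝ) < N := by exact_mod_cast hN
  have hr1 : (1 : ℝ) ≤ r := by exact_mod_cast (by omega : 1 ≤ r)
  set D : ℕ := ⌈r * (N * t)⌉₊ with hD
  have hDlo : r * (N * t) ≤ D := Nat.le_ceil _
  have hDhi : (D : ℝ) ≤ 2 * (r * (N * t)) := by
    have h1 : (D : ℝ) < r * (N * t) + 1 := Nat.ceil_lt_add_one (by positivity)
    nlinarith
  have hD1 : 1 ≤ D := by
    have : (1 : ℝ) ≤ D := by nlinarith
    exact_mod_cast this
  set q : ℝ := (N : ℝ) ^ r * t / 8 with hq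
  have hq0 : 0 < q := by positivity
  obtain ⟨T, hTS, hTB, hTD, hTq⟩ := exists_sparse_subset (Finset.univ.filter fun y => a y ≤ t) B
    (D := D) (q := q) hB hD1 (by
      rw [hκ, hq]
      have : (0 : ℝ) ≤ N ^ r := by positivity
      have h1 : 0 ≤ (r : ℝ) * (N * t) := by positivity
      nlinarith [mul_le_mul_of_nonneg_right hDlo this, mul_nonneg h1 this]) (by
      intro L hL hhalf
      have h1 := ha B hB L hL hhalf
      simp only [Finset.mem_filter, Finset.mem_univ, true_and]
      rw [hκ] at hhalf
      have h2 := mul_le_mul_of_nonneg_right hhalf ht.le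
      rw [hq]; linarith)
  have hTc : (0 : ℝ) < T.card := hq0.trans_le hTq
  have hTne : T.Nonempty := Finset.card_pos.1 (by exact_mod_cast hTc)
  set K : ℝ := 8 + 16 * r ^ 2 with hK
  have hK0 : 0 ≤ K := by positivity
  set F : ℕ → Set (ι → ℝ) := fun j => {u | ∀ y ∈ T, ¬ ∀ k, u (e k y) ≤ t * 4 ^ j} with hF
  have hFm : ∀ j, MeasurableSet (F j) := by
    intro j
    have : F j = ⋂ y ∈ T, (⋂ k, {u : ι → ℝ | u (e k y) ≤ t * 4 ^ j})ᶜ := by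
      ext u; simp [hF]
    rw [this]
    exact Finset.measurableSet_biInter _ fun y _ => (MeasurableSet.iInter fun k =>
      measurableSet_le (measurable_pi_apply _) measurable_const).compl
  have hFP : ∀ j, t * 4 ^ j ≤ 1 → (cube ι).real (F j) ≤ K * (1 / 8) ^ j := by
    intro j hj
    have hs0 : 0 < t * 4 ^ j := by positivity
    have h := cube_real_no_cheap_le e he (by omega) hTne hTD hs0 hj
    rw [hκ] at h
    refine h.trans ?_
    have h1 : 1 / (T.card * (t * 4 ^ j) ^ r) ≤ 8 * (1 / 8 : ℝ) ^ j := by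
      calc 1 / (T.card * (t * 4 ^ j) ^ r) ≤ 1 / (q * (t * 4 ^ j) ^ r) := by gcongr
        _ = 8 * (1 / (4 : ℝ) ^ r) ^ j := by
            have : q * (t * 4 ^ j) ^ r = ((N : ℝ) ^ r * t ^ (r + 1)) / 8 * (4 ^ r) ^ j := by
              rw [hq, mul_pow, ← pow_mul, ← pow_mul, mul_comm j r]; ring
            rw [this, hNt, one_div_pow]; field_simp
        _ ≤ _ := by
            gcongr
            calc (8 : ℝ) ≤ 4 ^ 2 := by norm_num
              _ ≤ 4 ^ r := pow_le_pow_right₀ (by norm_num) hr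
    have h2 : ((r * D : ℕ) : ℝ) / (T.card * (t * 4 ^ j)) ≤ 16 * r ^ 2 * (1 / 8 : ℝ) ^ j := by
      have h3 : (N : ℝ) * ((N : ℝ) ^ r)⁻¹ ≤ t * (1 / 2) ^ j := by
        refine le_of_sq_le_sq ?_ (by positivity)
        calc _ ≤ t ^ 3 := hNt3
          _ = t ^ 2 * t := by ring
          _ ≤ t ^ 2 * (1 / 4 ^ j) := by
              gcongr
              rw [le_div_iff₀ (by positivity)]; exact hj
          _ = (t * (1 / 2) ^ j) ^ 2 := by
              rw [mul_pow, ← pow_mul, mul_comm j 2, pow_mul,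
                show (1 / 2 : ℝ) ^ 2 = 1 / 4 by norm_num, one_div_pow]
      calc ((r * D : ℕ) : ℝ) / (T.card * (t * 4 ^ j))
          ≤ (r * (2 * (r * (N * t)))) / (q * (t * 4 ^ j)) := by
            push_cast; gcongr
        _ = 16 * r ^ 2 * ((N * ((N : ℝ) ^ r)⁻¹) / (t * 4 ^ j)) := by
            rw [hq]; field_simp; ring
        _ ≤ 16 * r ^ 2 * ((t * (1 / 2) ^ j) / (t * 4 ^ j)) := by gcongr
        _ = 16 * r ^ 2 * (1 / 8 : ℝ) ^ j := by
            rw [mul_div_mul_left _ _ ht.ne', ← div_pow]; norm_num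
    rw [hK, add_mul]
    exact add_le_add h1 h2
  have hex : ∃ M : ℕ, 1 ≤ t * 4 ^ M := by
    obtain ⟨M, hM⟩ := pow_unbounded_of_one_lt (1 / t) (by norm_num : (1 : ℝ) < 4)
    refine ⟨M, ?_⟩
    rw [div_lt_iff₀' ht] at hM; exact hM.le
  classical
  set M := Nat.find hex with hM
  have hMlt : ∀ j < M, t * 4 ^ j ≤ 1 := fun j hj => (not_le.1 (Nat.find_min hex hj)).le
  set Y : (ι → ℝ) → ℝ := fun u =>
    ∑ j ∈ Finset.range M, (F j).indicator (fun _ => (4 : ℝ) ^ j) u with hY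
  have hYi : Integrable Y (cube ι) :=
    integrable_finsetSum _ fun j _ => (integrable_const _).indicator (hFm j)
  have hY0 : ∀ u, 0 ≤ Y u := fun u => Finset.sum_nonneg fun j _ =>
    Set.indicator_nonneg (fun _ _ => by positivity) u
  have hpt : ∀ᵐ u ∂cube ι, ⨅ y ∈ Fintype.piFinset B, ENNReal.ofReal (a y + ∑ k, u (e k y)) ≤
      ENNReal.ofReal (t + r * t + 3 * r * t * Y u) := by
    filter_upwards [ae_mem_Icc_cube (ι := ι)] with u hu
    have hex' : ∃ j, u ∉ F j := by
      obtain ⟨y, hy⟩ := hTne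
      refine ⟨M, fun h => h y hy fun k => (hu _).2.trans (Nat.find_spec hex)⟩
    set j := Nat.find hex' with hj
    have hjM : j ≤ M := Nat.find_min' hex' (by
      obtain ⟨y, hy⟩ := hTne
      exact fun h => h y hy fun k => (hu _).2.trans (Nat.find_spec hex))
    have hjs : u ∉ F j := Nat.find_spec hex'
    obtain ⟨y, hyT, hyu⟩ : ∃ y ∈ T, ∀ k, u (e k y) ≤ t * 4 ^ j := by
      by_contra! hcon
      exact hjs fun y hy hall => (hcon y hy).elim fun k hk => hk.not_ge (hall k)
    have hay : a y ≤ t := (Finset.mem_filter.1 (hTS hyT)).2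
    refine (iInf₂_le y (hTB hyT)).trans (ENNReal.ofReal_le_ofReal ?_)
    have hsum : ∑ k, u (e k y) ≤ r * (t * 4 ^ j) := by
      rw [← hκ, ← Finset.card_univ, ← nsmul_eq_mul]
      exact Finset.sum_le_card_nsmul _ _ _ fun k _ => hyu k
    have hgeom : (4 : ℝ) ^ j = 1 + 3 * ∑ i ∈ Finset.range j, (4 : ℝ) ^ i := by
      rw [geom_sum_eq (by norm_num)]; ring
    have hYj : ∑ i ∈ Finset.range j, (4 : ℝ) ^ i ≤ Y u := by
      calc ∑ i ∈ Finset.range j, (4 : ℝ) ^ i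
          = ∑ i ∈ Finset.range j, (F i).indicator (fun _ => (4 : ℝ) ^ i) u := by
            refine Finset.sum_congr rfl fun i hi => ?_
            rw [Set.indicator_of_mem (not_not.1 (Nat.find_min hex' (Finset.mem_range.1 hi)))]
        _ ≤ _ := Finset.sum_le_sum_of_subset_of_nonneg (Finset.range_mono hjM) fun i _ _ =>
            Set.indicator_nonneg (fun _ _ => by positivity) u
    have hrt : 0 ≤ r * t := by positivity
    nlinarith [mul_le_mul_of_nonneg_left hYj hrt]
  refine (lintegral_mono_ae hpt).trans ?_
  have hnn : ∀ u, 0 ≤ t + r * t + 3 * r * t * Y u := fun u => by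
    have := hY0 u; positivity
  have hi : Integrable (fun u => t + r * t + 3 * r * t * Y u) (cube ι) :=
    (integrable_const _).add (hYi.const_mul _)
  rw [← ofReal_integral_eq_lintegral_ofReal hi (Filter.Eventually.of_forall hnn)]
  refine ENNReal.ofReal_le_ofReal ?_
  rw [integral_add (integrable_const _) (hYi.const_mul _), integral_const_mul]
  have hYint : ∫ u, Y u ∂cube ι ≤ 2 * K :=
    integral_scales_le M hFm (fun j hj => hFP j (hMlt j hj)) hK0
  have hrt : 0 ≤ 3 * r * t := by positivity
  have := mul_le_mul_of_nonneg_left hYint hrt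
  simp only [integral_const, probReal_univ, one_smul]
  linarith

end Row

/-! ### Entries of the tables -/

section Entries

variable {d n : ℕ}

/-- The index of the entry of the `j`-th table contributing to the weight of `x`. -/
def entry (j : Fin d) (x : Fin d → Fin n) : TableIndex d n := ⟨j, fun k => x k⟩

lemma entry_eq_iff {j j' : Fin d} {x x' : Fin d → Fin n} :
    entry j x = entry j' x' ↔ j = j' ∧ ∀ k, k ≠ j → x k = x' k := by
  constructor
  · intro h
    obtain rfl : j = j' := congrArg Sigma.fst h
    refine ⟨rfl, fun k hk => ?_⟩
    exact congrFun (eq_of_heq (Sigma.mk.inj_iff.1 h).2) ⟨k, hk⟩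
  · rintro ⟨rfl, h⟩
    exact congrArg (Sigma.mk j) (funext fun k => h k k.2)

lemma mkTuple_of_eq {i : Fin n} {x : Rest d → Fin n} {k : Fin d} (h : k.val = 0) :
    mkTuple i x k = i := dif_pos h

lemma mkTuple_rest (i : Fin n) (x : Rest d → Fin n) (k : Rest d) : mkTuple i x k = x k :=
  dif_neg k.2

/-- The entry of the first table for `(i, y)`, which does not depend on `i`. -/
def firstEntry (hd : 0 < d) (y : Rest d → Fin n) : TableIndex d n :=
  ⟨⟨0, hd⟩, fun k => y ⟨k, fun h => k.2 (Fin.ext h)⟩⟩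

lemma entry_zero_mkTuple (hd : 0 < d) (i : Fin n) (y : Rest d → Fin n) :
    entry ⟨0, hd⟩ (mkTuple i y) = firstEntry hd y :=
  congrArg (Sigma.mk _) (funext fun k => mkTuple_rest i y ⟨k, fun h => k.2 (Fin.ext h)⟩)

lemma firstEntry_injective (hd : 0 < d) : Function.Injective (firstEntry (n := n) hd) := by
  intro y y' h
  funext k
  exact congrFun (eq_of_heq (Sigma.mk.inj_iff.1 h).2) ⟨k, fun h' => k.2 (congrArg Fin.val h')⟩

lemma entry_mkTuple_eq_iff {i : Fin n} {k k' : Rest d} {y y' : Rest d → Fin n} :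
    entry k.1 (mkTuple i y) = entry k'.1 (mkTuple i y') ↔ k = k' ∧ offLine k y = offLine k y' := by
  rw [entry_eq_iff, offLine_eq_iff, Subtype.ext_iff]
  refine and_congr_right fun _ => ⟨fun h l hl => ?_, fun h l hl => ?_⟩
  · simpa only [mkTuple_rest] using h l fun h' => hl (Subtype.ext h')
  · by_cases hl0 : l.val = 0
    · rw [mkTuple_of_eq hl0, mkTuple_of_eq hl0]
    · exact (mkTuple_rest i y ⟨l, hl0⟩).trans ((h ⟨l, hl0⟩ fun h' =>
        hl (congrArg Subtype.val h')).trans (mkTuple_rest i y' ⟨l, hl0⟩).symm)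

/-- The entries, outside the first table, whose first coordinate is `i`. -/
def rowEntries (d : ℕ) (i : Fin n) : Finset (TableIndex d n) :=
  Finset.univ.image fun p : Rest d × (Rest d → Fin n) => entry p.1.1 (mkTuple i p.2)

lemma entry_mem_rowEntries (i : Fin n) (k : Rest d) (y : Rest d → Fin n) :
    entry k.1 (mkTuple i y) ∈ rowEntries d i :=
  Finset.mem_image.2 ⟨(k, y), Finset.mem_univ _, rfl⟩

lemma firstEntry_notMem_rowEntries (hd : 0 < d) (i : Fin n) (y : Rest d → Fin n) :
    firstEntry hd y ∉ rowEntries d i := by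
  intro h
  obtain ⟨⟨k, y'⟩, -, h⟩ := Finset.mem_image.1 h
  exact k.2 (congrArg Fin.val (congrArg Sigma.fst h))

lemma entry_notMem_rowEntries (hd : 0 < d) {i i' : Fin n} (hi : i' ≠ i) (k : Rest d)
    (y : Rest d → Fin n) : entry k.1 (mkTuple i' y) ∉ rowEntries d i := by
  intro h
  obtain ⟨⟨k', y'⟩, -, h⟩ := Finset.mem_image.1 h
  have h0 := (entry_eq_iff.1 h).2 ⟨0, hd⟩ fun h' => k'.2 (congrArg Fin.val h'.symm)
  rw [mkTuple_of_eq rfl, mkTuple_of_eq rfl] at h0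
  exact hi h0.symm

lemma weight_mkTuple (hd : 0 < d) (a : TableIndex d n → ℝ) (i : Fin n) (y : Rest d → Fin n) :
    weight a (mkTuple i y) = a (firstEntry hd y) + ∑ k : Rest d, a (entry k.1 (mkTuple i y)) := by
  have h : weight a (mkTuple i y) = ∑ j, a (entry j (mkTuple i y)) := rfl
  rw [h, ← Finset.add_sum_erase _ _ (Finset.mem_univ (⟨0, hd⟩ : Fin d)), entry_zero_mkTuple]
  congr 1
  refine Finset.sum_subtype _ (fun j => ?_) _
  simp [Fin.ext_iff]

lemma measurable_weight (x : Fin d → Fin n) :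
    Measurable fun a : TableIndex d n → ℝ => weight a x :=
  Finset.measurable_sum _ fun _ _ => measurable_pi_apply _

lemma weight_nonneg {a : TableIndex d n → ℝ} (ha : ∀ e, a e ∈ Set.Icc (0 : ℝ) 1)
    (x : Fin d → Fin n) : 0 ≤ weight a x :=
  Finset.sum_nonneg fun _ _ => (ha _).1

lemma weight_le {a : TableIndex d n → ℝ} (ha : ∀ e, a e ∈ Set.Icc (0 : ℝ) 1)
    (x : Fin d → Fin n) : weight a x ≤ d := by
  have : ∑ j : Fin d, a ⟨j, fun k => x k⟩ ≤ (Finset.univ : Finset (Fin d)).card • (1 : ℝ) :=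
    Finset.sum_le_card_nsmul _ _ _ fun j _ => (ha _).2
  simpa [weight] using this

/-- For `d ≥ 2` different tuples use different entries of some table. -/
lemma ae_weight_injective (hd : 2 ≤ d) :
    ∀ᵐ a ∂cube (TableIndex d n), Function.Injective (weight a) := by
  have h : ∀ x x' : Fin d → Fin n, x ≠ x' →
      ∀ᵐ a ∂cube (TableIndex d n), weight a x - weight a x' ≠ 0 := by
    intro x x' hxx
    obtain ⟨k, hk⟩ := Function.ne_iff.1 hxx
    have : Nontrivial (Fin d) := Fin.nontrivial_iff_two_le.2 hd
    obtain ⟨j, hj⟩ := exists_ne k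
    let φ : (TableIndex d n → ℝ) →ₗ[ℝ] ℝ :=
      ∑ j : Fin d, LinearMap.proj (entry j x) - ∑ j : Fin d, LinearMap.proj (entry j x')
    have hφ : ∀ a, φ a = weight a x - weight a x' := by
      intro a; simp [φ, weight, entry, LinearMap.sum_apply]
    have hne : φ ≠ 0 := by
      intro h0
      have h1 : φ (Pi.single (entry j x) 1) = 0 := by rw [h0]; rfl
      have hs : ∀ y : Fin d → Fin n, weight (Pi.single (entry j x) 1) y =
          if entry j y = entry j x then 1 else 0 := by
        intro y
        change ∑ j', (Pi.single (entry j x) (1 : ℝ) : TableIndex d n → ℝ) (entry j' y) = _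
        rw [Finset.sum_eq_single j]
        · rw [Pi.single_apply]
        · intro j' _ hj'
          rw [Pi.single_apply, if_neg fun h => hj' (entry_eq_iff.1 h).1]
        · intro h; exact absurd (Finset.mem_univ j) h
      rw [hφ, hs, hs, if_pos rfl, if_neg fun h => hk ((entry_eq_iff.1 h).2 k hj.symm).symm] at h1
      norm_num at h1
    filter_upwards [cube_ae_linear_ne_zero φ hne] with a ha
    rwa [← hφ]
  have h' : ∀ᵐ a ∂cube (TableIndex d n), ∀ x x' : Fin d → Fin n, x ≠ x' →
      weight a x - weight a x' ≠ 0 := by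
    rw [ae_all_iff]; intro x
    rw [ae_all_iff]; intro x'
    by_cases hxx : x = x'
    · simp [hxx]
    · filter_upwards [h x x' hxx] with a ha _ using ha
  filter_upwards [h'] with a ha x x' hxx
  by_contra hne
  exact ha x x' hne (sub_eq_zero.2 hxx)

end Entries

/-! ### The greedy algorithm -/

section Greedy

variable {d n : ℕ} {W : (Fin d → Fin n) → ℝ}

lemma GreedyState.card_add {m : ℕ} {B : Rest d → Finset (Fin n)} {T : Finset (Fin d → Fin n)}
    (h : GreedyState W m B T) (k : Rest d) : (B k).card + m = n := by
  induction h with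
  | start => simp
  | step i B T x _ hmem _ ih =>
    have := Finset.card_erase_add_one (hmem k)
    simp only
    omega

lemma GreedyState.congr {W' : (Fin d → Fin n) → ℝ} {m : ℕ} {B : Rest d → Finset (Fin n)}
    {T : Finset (Fin d → Fin n)} (h : GreedyState W m B T)
    (hW : ∀ i : Fin n, i.val < m → ∀ x, W (mkTuple i x) = W' (mkTuple i x)) :
    GreedyState W' m B T := by
  induction h with
  | start => exact .start
  | step i B T x _ hmem hmin ih =>
    refine .step i B T x (ih fun i' hi' => hW i' (by omega)) hmem fun y hy => ?_
    rw [← hW i (by omega), ← hW i (by omega)]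
    exact hmin y hy

lemma mkTuple_injective (hd : 0 < d) {i i' : Fin n} {x x' : Rest d → Fin n}
    (h : mkTuple i x = mkTuple i' x') : i = i' ∧ x = x' := by
  constructor
  · have := congrFun h ⟨0, hd⟩
    rwa [mkTuple_of_eq rfl, mkTuple_of_eq rfl] at this
  · funext k
    have := congrFun h k
    rwa [mkTuple_rest, mkTuple_rest] at this

lemma greedyState_zero_iff {B : Rest d → Finset (Fin n)} {T : Finset (Fin d → Fin n)} :
    GreedyState W 0 B T ↔ B = (fun _ => Finset.univ) ∧ T = ∅ := by
  constructor
  · intro h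
    cases h
    exact ⟨rfl, rfl⟩
  · rintro ⟨rfl, rfl⟩; exact .start

lemma greedyState_succ_iff {m : ℕ} {B : Rest d → Finset (Fin n)} {T : Finset (Fin d → Fin n)} :
    GreedyState W (m + 1) B T ↔ ∃ (i : Fin n) (B' : Rest d → Finset (Fin n))
      (T' : Finset (Fin d → Fin n)) (x : Rest d → Fin n), (i.val = m ∧ (∀ k, x k ∈ B' k) ∧
        B = (fun k => (B' k).erase (x k)) ∧ T = insert (mkTuple i x) T') ∧ GreedyState W m B' T' ∧
        ∀ y : Rest d → Fin n, (∀ k, y k ∈ B' k) → W (mkTuple i x) ≤ W (mkTuple i y) := by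
  constructor
  · intro h
    generalize hm : m + 1 = m' at h
    cases h with
    | start => omega
    | step i B' T' x hprev hmem hmin =>
      obtain rfl : m = i.val := by omega
      exact ⟨i, B', T', x, ⟨rfl, hmem, rfl, rfl⟩, hprev, hmin⟩
  · rintro ⟨i, B', T', x, ⟨rfl, hmem, rfl, rfl⟩, hprev, hmin⟩
    exact .step i B' T' x hprev hmem hmin

/-- Without ties the algorithm is deterministic. -/
lemma GreedyState.unique (hd : 0 < d) (hW : Function.Injective W) (m : ℕ)
    {B B' : Rest d → Finset (Fin n)} {T T' : Finset (Fin d → Fin n)}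
    (h : GreedyState W m B T) (h' : GreedyState W m B' T') : B = B' := by
  induction m generalizing B B' T T' with
  | zero => rw [(greedyState_zero_iff.1 h).1, (greedyState_zero_iff.1 h').1]
  | succ m ih =>
    obtain ⟨i, B₁, T₁, x, ⟨hi, hx, rfl, -⟩, h₁, hmin⟩ := greedyState_succ_iff.1 h
    obtain ⟨i', B₂, T₂, x', ⟨hi', hx', rfl, -⟩, h₂, hmin'⟩ := greedyState_succ_iff.1 h'
    obtain rfl := ih h₁ h₂
    obtain rfl : i = i' := Fin.ext (hi.trans hi'.symm)
    rw [(mkTuple_injective hd (hW (le_antisymm (hmin x' hx') (hmin' x hx)))).2]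

lemma exists_greedyState (W : (Fin d → Fin n) → ℝ) {m : ℕ} (hm : m ≤ n) :
    ∃ B T, GreedyState W m B T := by
  induction m with
  | zero => exact ⟨_, _, .start⟩
  | succ m ih =>
    obtain ⟨B, T, h⟩ := ih (by omega)
    have hne : (Fintype.piFinset B).Nonempty := by
      refine Fintype.piFinset_nonempty.2 fun k => Finset.card_pos.1 ?_
      have := h.card_add k
      omega
    obtain ⟨x, hx, hmin⟩ := Finset.exists_min_image _ (fun x => W (mkTuple ⟨m, by omega⟩ x)) hne
    exact ⟨_, _, .step ⟨m, by omega⟩ B T x h (Fintype.mem_piFinset.1 hx) fun y hy =>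
      hmin y (Fintype.mem_piFinset.2 hy)⟩

/-- The tuples chosen by the algorithm are the graph of a partial assignment. -/
lemma GreedyState.exists_partial {m : ℕ} {B : Rest d → Finset (Fin n)}
    {T : Finset (Fin d → Fin n)} (h : GreedyState W m B T) :
    ∃ x : Fin n → Rest d → Fin n,
      (∀ t ∈ T, ∃ i : Fin n, i.val < m ∧ t = mkTuple i (x i)) ∧
      (∀ i : Fin n, i.val < m → ∀ k, x i k ∉ B k) ∧
      ∀ k, Set.InjOn (fun i => x i k) {i : Fin n | i.val < m} := by
  induction h with
  | start =>
    refine ⟨fun i _ => i, by simp, fun i hi => absurd hi (Nat.not_lt_zero _), fun k i hi => ?_⟩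
    exact absurd hi (Nat.not_lt_zero _)
  | step i B T y _ hmem _ ih =>
    obtain ⟨x, hT, hB, hinj⟩ := ih
    have hup : ∀ j : Fin n, j.val < i.val → Function.update x i y j = x j := fun j hj =>
      Function.update_of_ne (fun h => hj.ne (congrArg Fin.val h)) _ _
    have hcase : ∀ j : Fin n, j.val < i.val + 1 → j.val < i.val ∨ j = i := fun j hj =>
      (Nat.lt_succ_iff_lt_or_eq.1 hj).imp_right Fin.ext
    refine ⟨Function.update x i y, ?_, ?_, ?_⟩
    · intro t ht
      rcases Finset.mem_insert.1 ht with rfl | ht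
      · exact ⟨i, Nat.lt_succ_self _, by rw [Function.update_self]⟩
      · obtain ⟨j, hj, rfl⟩ := hT t ht
        exact ⟨j, hj.trans (Nat.lt_succ_self _), by rw [hup j hj]⟩
    · intro j hj k
      rcases hcase j hj with hj | rfl
      · rw [hup j hj]
        exact fun h => hB j hj k (Finset.mem_of_mem_erase h)
      · rw [Function.update_self]
        exact Finset.notMem_erase _ _
    · intro k j hj j' hj' hjj
      simp only at hjj
      rcases hcase j hj with hj | rfl <;> rcases hcase j' hj' with hj' | rfl
      · rw [hup j hj, hup j' hj'] at hjj
        exact hinj k hj hj' hjj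
      · rw [hup j hj, Function.update_self] at hjj
        exact absurd (hjj ▸ hmem k) (hB j hj k)
      · rw [hup j' hj', Function.update_self] at hjj
        exact absurd (hjj ▸ hmem k) (hB j' hj' k)
      · rfl

lemma exists_isGreedyOutput (W : (Fin d → Fin n) → ℝ) {m : ℕ} (hm : m ≤ n) :
    ∃ σ, IsGreedyOutput W m σ := by
  obtain ⟨B, T, h⟩ := exists_greedyState W hm
  obtain ⟨x, hT, -, hinj⟩ := h.exists_partial
  have hσ : ∀ k : Rest d, ∃ g : Equiv.Perm (Fin n), ∀ i : Fin n, i.val < m → g i = x i k := by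
    intro k
    obtain ⟨g, hg⟩ := Set.MapsTo.exists_equiv_extend_of_card_eq (t := Finset.univ)
      (s := {i : Fin n | i.val < m}) (f := fun i => x i k) (by simp) (fun _ _ => by simp) (hinj k)
    exact ⟨g.trans (Equiv.subtypeUnivEquiv fun _ => Finset.mem_univ _), hg⟩
  choose σ hσ using hσ
  refine ⟨σ, B, T, h, fun t ht => ?_⟩
  obtain ⟨i, hi, rfl⟩ := hT t ht
  exact ⟨i, congrArg (mkTuple i) (funext fun k => hσ k i hi)⟩

/-- Each step of the algorithm chooses a tuple of minimal weight in the box it has reached. -/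
lemma GreedyState.exists_step {m : ℕ} {B : Rest d → Finset (Fin n)}
    {T : Finset (Fin d → Fin n)} (h : GreedyState W m B T) (i : Fin n) (hi : i.val < m) :
    ∃ B' T' x, GreedyState W i.val B' T' ∧ mkTuple i x ∈ T ∧
      ∀ y : Rest d → Fin n, (∀ k, y k ∈ B' k) → W (mkTuple i x) ≤ W (mkTuple i y) := by
  induction h with
  | start => exact absurd hi (Nat.not_lt_zero _)
  | step j B T x hprev _ hmin ih =>
    rcases Nat.lt_succ_iff_lt_or_eq.1 hi with hlt | heq
    · obtain ⟨B', T', y, h1, h2, h3⟩ := ih hlt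
      exact ⟨B', T', y, h1, Finset.mem_insert_of_mem h2, h3⟩
    · obtain rfl := Fin.ext heq
      exact ⟨B, T, x, hprev, Finset.mem_insert_self _ _, hmin⟩

lemma measurableSet_greedyState (m : ℕ) (B : Rest d → Finset (Fin n))
    (T : Finset (Fin d → Fin n)) :
    MeasurableSet {a : TableIndex d n → ℝ | GreedyState (weight a) m B T} := by
  induction m generalizing B T with
  | zero => simp only [greedyState_zero_iff]; exact MeasurableSet.const _
  | succ m ih =>
    simp only [greedyState_succ_iff]
    simp only [Set.ofPred_exists, Set.ofPred_and, Set.ofPred_forall]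
    exact MeasurableSet.iUnion fun i => MeasurableSet.iUnion fun B' =>
      MeasurableSet.iUnion fun T' => MeasurableSet.iUnion fun x =>
        (((MeasurableSet.const _).inter ((MeasurableSet.iInter fun _ =>
        MeasurableSet.const _).inter ((MeasurableSet.const _).inter (MeasurableSet.const _)))).inter
        ((ih B' T').inter (MeasurableSet.iInter fun y => MeasurableSet.iInter fun _ =>
          measurableSet_le (measurable_weight _) (measurable_weight _))))

/-- The algorithm can reach the box of unused values `B` in `i` steps. -/
def reachSet (i : ℕ) (B : Rest d → Finset (Fin n)) : Set (TableIndex d n → ℝ) :=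
  {a | ∃ T, GreedyState (weight a) i B T}

lemma measurableSet_reachSet (i : ℕ) (B : Rest d → Finset (Fin n)) :
    MeasurableSet (reachSet i B) := by
  have : reachSet i B = ⋃ T, {a | GreedyState (weight a) i B T} := by ext; simp [reachSet]
  rw [this]
  exact MeasurableSet.iUnion fun T => measurableSet_greedyState i B T

/-- The minimal weight of a tuple in the box `{i} × ∏ B k`, capped at `d`. -/
noncomputable def boxMin (i : Fin n) (B : Rest d → Finset (Fin n)) (a : TableIndex d n → ℝ) :
    ENNReal :=
  ENNReal.ofReal d ⊓ ⨅ y ∈ Fintype.piFinset B, ENNReal.ofReal (weight a (mkTuple i y))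

lemma measurable_boxMin (i : Fin n) (B : Rest d → Finset (Fin n)) : Measurable (boxMin i B) :=
  measurable_const.inf (Measurable.iInf fun _ => Measurable.iInf fun _ =>
    (measurable_weight _).ennreal_ofReal)

/-- The cost of the tuple with first coordinate `i` chosen by the algorithm. In case of ties the
contributions of all boxes that can be reached are added. -/
noncomputable def stepCost (i : Fin n) (a : TableIndex d n → ℝ) : ENNReal :=
  ∑ B : Rest d → Finset (Fin n), (reachSet i.val B).indicator (boxMin i B) a

lemma measurable_stepCost (i : Fin n) : Measurable (stepCost (d := d) i) :=
  Finset.measurable_sum _ fun B _ => (measurable_boxMin i B).indicator (measurableSet_reachSet _ _)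

lemma cost_le_of_isGreedyOutput (hd : 0 < d) {a : TableIndex d n → ℝ}
    (ha : ∀ e, a e ∈ Set.Icc (0 : ℝ) 1) {m : ℕ} {σ : Assignment d n}
    (h : IsGreedyOutput (weight a) m σ) :
    ENNReal.ofReal (cost (weight a) σ) ≤
      ∑ i : Fin n, (if i.val < m then stepCost i a else ENNReal.ofReal d) := by
  obtain ⟨B, T, hs, hT⟩ := h
  rw [cost, ENNReal.ofReal_sum_of_nonneg fun i _ => weight_nonneg ha _]
  refine Finset.sum_le_sum fun i _ => ?_
  split_ifs with hi
  · obtain ⟨B', T', x, hs', hx, hmin⟩ := hs.exists_step i hi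
    obtain ⟨i', hi'⟩ := hT _ hx
    obtain ⟨rfl, -⟩ := mkTuple_injective hd hi'
    rw [hi']
    refine le_trans ?_ (Finset.single_le_sum (f := fun B : Rest d → Finset (Fin n) =>
      (reachSet i'.val B).indicator (boxMin i' B) a) (fun _ _ => zero_le) (Finset.mem_univ B'))
    rw [Set.indicator_of_mem (show a ∈ reachSet i'.val B' from ⟨T', hs'⟩)]
    refine le_inf (ENNReal.ofReal_le_ofReal (weight_le ha _)) (le_iInf₂ fun y hy => ?_)
    exact ENNReal.ofReal_le_ofReal (hmin y (Fintype.mem_piFinset.1 hy))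
  · exact ENNReal.ofReal_le_ofReal (weight_le ha _)

end Greedy

/-! ### The scale of the cheapest tuple -/

/-- The order of magnitude `N ^ (1 / d - 1)` of the least weight in a box of side `N`. -/
noncomputable def scale (d N : ℕ) : ℝ := (N : ℝ) ^ (1 / (d : ℝ) - 1)

lemma scale_pos (d : ℕ) {N : ℕ} (hN : 1 ≤ N) : 0 < scale d N :=
  Real.rpow_pos_of_pos (by exact_mod_cast hN) _

lemma mul_scale (d : ℕ) {N : ℕ} (hN : 1 ≤ N) : N * scale d N = (N : ℝ) ^ (1 / (d : ℝ)) := by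
  have h : (0 : ℝ) < N := by exact_mod_cast hN
  rw [scale, Real.rpow_sub_one h.ne']
  field_simp

lemma pow_mul_scale_pow {r N : ℕ} (hN : 1 ≤ N) :
    (N : ℝ) ^ r * scale (r + 1) N ^ (r + 1) = 1 := by
  have h : (0 : ℝ) < N := by exact_mod_cast hN
  have h1 := congrArg (· ^ (r + 1)) (mul_scale (r + 1) hN)
  simp only [mul_pow] at h1
  rw [← Real.rpow_natCast ((N : ℝ) ^ _), ← Real.rpow_mul h.le,
    one_div_mul_cancel (by positivity), Real.rpow_one, pow_succ (N : ℝ)] at h1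
  refine mul_right_cancel₀ h.ne' ?_
  linarith

lemma one_div_le_scale (d : ℕ) {N : ℕ} (hN : 1 ≤ N) : 1 / (N : ℝ) ≤ scale d N := by
  have h : (1 : ℝ) ≤ N := by exact_mod_cast hN
  rw [div_le_iff₀' (by linarith), mul_scale d hN]
  exact Real.one_le_rpow h (by positivity)

lemma sum_scale_le {d : ℕ} (hd : 1 ≤ d) (n : ℕ) :
    ∑ N ∈ Finset.range n, scale d (N + 1) ≤ d * (n : ℝ) ^ (1 / (d : ℝ)) := by
  have hd0 : (0 : ℝ) < d := by exact_mod_cast hd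
  have hd1 : (1 : ℝ) ≤ d := by exact_mod_cast hd
  induction n with
  | zero => simp only [Finset.range_zero, Finset.sum_empty]; positivity
  | succ n ih =>
    rw [Finset.sum_range_succ]
    have hx : (0 : ℝ) < (n + 1 : ℕ) := by positivity
    have hx1 : (1 : ℝ) ≤ (n + 1 : ℕ) := by exact_mod_cast Nat.le_add_left 1 n
    -- Bernoulli's inequality bounds the increment of `x ^ (1 / d)` from below
    have hb := rpow_one_add_le_one_add_mul_self (s := -(1 / ((n + 1 : ℕ) : ℝ)))
      (by rw [neg_le_neg_iff, div_le_one hx]; exact hx1) (p := 1 / (d : ℝ)) (by positivity)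
      (by rw [div_le_one hd0]; exact hd1)
    have hn : (n : ℝ) = (n + 1 : ℕ) * (1 + -(1 / ((n + 1 : ℕ) : ℝ))) := by
      field_simp; push_cast; ring
    have hn' : (n : ℝ) ^ (1 / (d : ℝ)) = ((n + 1 : ℕ) : ℝ) ^ (1 / (d : ℝ)) *
        (1 + -(1 / ((n + 1 : ℕ) : ℝ))) ^ (1 / (d : ℝ)) := by
      conv_lhs => rw [hn]
      refine Real.mul_rpow hx.le ?_
      have : 1 / ((n + 1 : ℕ) : ℝ) ≤ 1 := by rw [div_le_one hx]; exact hx1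
      linarith
    have hs : d * (((n + 1 : ℕ) : ℝ) ^ (1 / (d : ℝ)) *
        (1 + 1 / (d : ℝ) * -(1 / ((n + 1 : ℕ) : ℝ)))) =
        d * ((n + 1 : ℕ) : ℝ) ^ (1 / (d : ℝ)) - scale d (n + 1) := by
      rw [← mul_scale d (Nat.le_add_left 1 n)]
      field_simp
      ring
    have : d * (n : ℝ) ^ (1 / (d : ℝ)) ≤
        d * ((n + 1 : ℕ) : ℝ) ^ (1 / (d : ℝ)) - scale d (n + 1) := by
      rw [← hs, hn']
      gcongr
    linarith

/-- The bound of `cube_real_not_wellSpread_le` is small, as long as the side of the boxes is at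
least a fixed power of the size of the table. The decisive comparison is between the
`N ^ (r - 1)` bits needed to choose lines and the exponent `N ^ (r - 1 + 1 / (r + 1))`. -/
lemma exists_entropy_bound {r : ℕ} (hr : 2 ≤ r) :
    ∃ N₀ : ℕ, 1 ≤ N₀ ∧ ∀ N : ℕ, N₀ ≤ N → ∀ n : ℕ, 1 ≤ n → n ≤ N ^ (r + 2) →
      ((n : ℝ) ^ N) ^ r * (2 ^ N ^ (r - 1)) ^ r * Real.exp (-((N : ℝ) ^ r * scale (r + 1) N / 8)) ≤
        1 / N := by
  set ε : ℝ := 1 / (16 * (r * (r + 2) + 1)) with hε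
  have hε0 : 0 < ε := by positivity
  have hp : (0 : ℝ) < 1 / ((r + 1 : ℕ) : ℝ) := by positivity
  have hlog := ((isLittleO_log_rpow_atTop hp).bound hε0)
  have hbig := (tendsto_rpow_atTop hp).eventually_ge_atTop (16 * (r : ℝ))
  obtain ⟨x₀, hx₀⟩ := Filter.eventually_atTop.1 (hlog.and hbig)
  refine ⟨max 1 ⌈x₀⌉₊, le_max_left _ _, fun N hN n hn hnN => ?_⟩
  have hN1 : 1 ≤ N := (le_max_left _ _).trans hN
  have hNR : (1 : ℝ) ≤ N := by exact_mod_cast hN1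
  obtain ⟨h1, h2⟩ := hx₀ N ((Nat.le_ceil x₀).trans (by exact_mod_cast (le_max_right _ _).trans hN))
  have hlog0 : 0 ≤ Real.log N := Real.log_nonneg hNR
  rw [Real.norm_of_nonneg hlog0, Real.norm_of_nonneg (by positivity),
    ← mul_scale (r + 1) hN1] at h1
  rw [← mul_scale (r + 1) hN1] at h2
  set M : ℝ := (N : ℝ) ^ (r - 1) with hM
  have hM1 : 1 ≤ M := one_le_pow₀ hNR
  have hNM : (N : ℝ) ≤ M := by
    calc (N : ℝ) = N ^ 1 := (pow_one _).symm
      _ ≤ M := pow_le_pow_right₀ hNR (by omega)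
  have e1 : ((n : ℝ) ^ N) ^ r ≤ Real.exp (M * (r * (r + 2) * Real.log N)) := by
    calc ((n : ℝ) ^ N) ^ r ≤ (((N : ℝ) ^ (r + 2)) ^ N) ^ r := by
          gcongr; exact_mod_cast hnN
      _ = Real.exp (N * (r * (r + 2) * Real.log N)) := by
          conv_lhs => rw [← Real.exp_log (show (0 : ℝ) < N by linarith)]
          rw [← Real.exp_nat_mul, ← Real.exp_nat_mul, ← Real.exp_nat_mul]
          congr 1; push_cast; ring
      _ ≤ _ := by gcongr
  have e2 : ((2 : ℝ) ^ N ^ (r - 1)) ^ r ≤ Real.exp (M * r) := by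
    calc ((2 : ℝ) ^ N ^ (r - 1)) ^ r ≤ (Real.exp 1 ^ N ^ (r - 1)) ^ r := by
          gcongr
          have := Real.add_one_le_exp 1; linarith
      _ = _ := by
          rw [← Real.exp_nat_mul, ← Real.exp_nat_mul]
          congr 1; push_cast; rw [hM]; ring
  have e3 : (N : ℝ) ^ r * scale (r + 1) N = M * (N * scale (r + 1) N) := by
    obtain ⟨q, rfl⟩ : ∃ q, r = q + 1 := ⟨r - 1, by omega⟩
    rw [hM, Nat.add_sub_cancel]; ring
  have e4 : r * (r + 2) * Real.log N + r + Real.log N ≤ N * scale (r + 1) N / 8 := by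
    have : (r * (r + 2) + 1) * Real.log N ≤ (r * (r + 2) + 1) * (ε * (N * scale (r + 1) N)) := by
      gcongr
    have h3 : ((r : ℝ) * (r + 2) + 1) * (ε * (N * scale (r + 1) N)) = N * scale (r + 1) N / 16 := by
      rw [hε]; field_simp
    linarith
  rw [e3]
  calc _ ≤ Real.exp (M * (r * (r + 2) * Real.log N)) * Real.exp (M * r) *
        Real.exp (-(M * (N * scale (r + 1) N) / 8)) := by gcongr
    _ = Real.exp (M * (r * (r + 2) * Real.log N + r - N * scale (r + 1) N / 8)) := by
        rw [← Real.exp_add, ← Real.exp_add]; congr 1; ring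
    _ ≤ Real.exp (-Real.log N) := by
        refine Real.exp_le_exp.2 ?_
        have h5 : M * (r * (r + 2) * Real.log N + r - N * scale (r + 1) N / 8) ≤
            M * (-Real.log N) := by gcongr; linarith
        nlinarith
    _ = 1 / N := by rw [Real.exp_neg, Real.exp_log (by linarith), one_div]

/-! ### The expected cost of a step -/

section Step

variable {d n : ℕ}

lemma card_rest (hd : 0 < d) : Fintype.card (Rest d) = d - 1 := by
  have : (Finset.univ.filter fun k : Fin d => k.val ≠ 0) = Finset.univ.erase ⟨0, hd⟩ := by
    ext k; simp [Fin.ext_iff]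
  rw [Fintype.card_subtype, this, Finset.card_erase_of_mem (Finset.mem_univ _), Finset.card_univ,
    Fintype.card_fin]

/-- The boxes reached in `i` steps do not depend on the entries used in the next step. -/
lemma mem_reachSet_congr (hd : 0 < d) (i : Fin n) (B : Rest d → Finset (Fin n))
    {a a' : TableIndex d n → ℝ} (h : ∀ e ∉ rowEntries d i, a e = a' e)
    (ha : a ∈ reachSet i.val B) : a' ∈ reachSet i.val B := by
  obtain ⟨T, hT⟩ := ha
  refine ⟨T, hT.congr fun i' hi' x => ?_⟩
  rw [weight_mkTuple hd, weight_mkTuple hd, h _ (firstEntry_notMem_rowEntries hd i x)]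
  congr 1
  exact Finset.sum_congr rfl fun k _ => h _ (entry_notMem_rowEntries hd
    (fun h' => hi'.ne (congrArg Fin.val h')) k x)

/-- Almost surely there are no ties, and only one box can be reached. -/
lemma ae_sum_reachSet_le (hd : 2 ≤ d) (i : ℕ) :
    ∀ᵐ a ∂cube (TableIndex d n),
      ∑ B : Rest d → Finset (Fin n),
        (reachSet i B).indicator (1 : (TableIndex d n → ℝ) → ENNReal) a ≤ 1 := by
  filter_upwards [ae_weight_injective hd] with a ha
  by_cases hex : ∃ B₀ : Rest d → Finset (Fin n), a ∈ reachSet i B₀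
  · obtain ⟨B₀, T₀, h₀⟩ := hex
    rw [Finset.sum_eq_single B₀]
    · exact Set.indicator_le_self' (fun _ _ => zero_le_one) a
    · intro B _ hB
      refine Set.indicator_of_notMem (fun h => hB ?_) _
      obtain ⟨T, hT⟩ := h
      exact hT.unique (by omega) ha i h₀
    · intro h; exact absurd (Finset.mem_univ _) h
  · push Not at hex
    rw [Finset.sum_eq_zero fun B _ => Set.indicator_of_notMem (hex B) _]
    exact zero_le_one

/-- The constant of `lintegral_box_le`. -/
noncomputable def boxConst (r : ℕ) : ℝ := 1 + r + 6 * r * (8 + 16 * r ^ 2)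

lemma boxConst_pos (r : ℕ) : 0 < boxConst r := by unfold boxConst; positivity

/-- The bound for the expected minimal weight in a box: `d` unless the first table is well
spread. -/
noncomputable def boxBound (hd : 0 < d) (N : ℕ) (a : TableIndex d n → ℝ) : ENNReal :=
  ENNReal.ofReal (boxConst (d - 1) * scale d N) +
    {a : TableIndex d n → ℝ | ¬ WellSpread N (scale d N) fun y => a (firstEntry hd y)}.indicator
      (fun _ => ENNReal.ofReal d) a

lemma measurableSet_not_wellSpread (hd : 0 < d) (N : ℕ) (t : ℝ) :
    MeasurableSet {a : TableIndex d n → ℝ | ¬ WellSpread N t fun y => a (firstEntry hd y)} :=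
  (measurableSet_wellSpread N t (firstEntry hd)).compl

lemma measurable_boxBound (hd : 0 < d) (N : ℕ) : Measurable (boxBound (n := n) hd N) :=
  Measurable.fun_add measurable_const
    (measurable_const.indicator (measurableSet_not_wellSpread hd N _))

open Function in
/-- Integrating over the entries used in step `i` first, while the box reached and the first table
are fixed. -/
lemma lintegral_indicator_boxMin_le (hd : 3 ≤ d) (i : Fin n) {N : ℕ} (hN : N + i.val = n)
    (B : Rest d → Finset (Fin n)) :
    ∫⁻ a, (reachSet i.val B).indicator (boxMin i B) a ∂cube (TableIndex d n) ≤
      ∫⁻ a, (reachSet i.val B).indicator (boxBound (by omega) N) a ∂cube (TableIndex d n) := by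
  classical
  have hd0 : 0 < d := by omega
  have hN1 : 1 ≤ N := by have := i.isLt; omega
  refine lintegral_le_of_lmarginal_le (rowEntries d i)
    ((measurable_boxMin i B).indicator (measurableSet_reachSet _ _))
    ((measurable_boxBound hd0 N).indicator (measurableSet_reachSet _ _)) fun a => ?_
  simp only [lmarginal]
  have hoff : ∀ u : (e : rowEntries d i) → ℝ, ∀ e ∉ rowEntries d i,
      updateFinset a (rowEntries d i) u e = a e := fun u e he => by
    simp [updateFinset, he]
  have hfirst : ∀ u : (e : rowEntries d i) → ℝ, ∀ y,
      updateFinset a (rowEntries d i) u (firstEntry hd0 y) = a (firstEntry hd0 y) :=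
    fun u y => hoff u _ (firstEntry_notMem_rowEntries hd0 i y)
  by_cases hreach : a ∈ reachSet i.val B
  · have hmem : ∀ u : (e : rowEntries d i) → ℝ,
        updateFinset a (rowEntries d i) u ∈ reachSet i.val B := fun u =>
      mem_reachSet_congr hd0 i B (fun e he => (hoff u e he).symm) hreach
    have hB : ∀ k, (B k).card = N := fun k => by
      obtain ⟨T, hT⟩ := hreach
      have := hT.card_add k
      omega
    have hbound : ∀ u : (e : rowEntries d i) → ℝ,
        boxBound hd0 N (updateFinset a (rowEntries d i) u) = boxBound hd0 N a := fun u => by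
      simp only [boxBound, Set.indicator_apply, Set.mem_ofPred_eq, hfirst]
    simp only [Set.indicator_of_mem (hmem _), hbound, lintegral_const, measure_univ, mul_one]
    by_cases hW : WellSpread N (scale d N) fun y => a (firstEntry hd0 y)
    · let e : Rest d → (Rest d → Fin n) → rowEntries d i := fun k y =>
        ⟨entry k.1 (mkTuple i y), entry_mem_rowEntries i k y⟩
      have he : ∀ k k' y y', e k y = e k' y' ↔ k = k' ∧ offLine k y = offLine k y' :=
        fun k k' y y' => Subtype.ext_iff.trans entry_mkTuple_eq_iff
      have hpow := pow_mul_scale_pow (r := d - 1) hN1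
      rw [Nat.sub_add_cancel (by omega : 1 ≤ d)] at hpow
      have hmain := lintegral_box_le e he (card_rest hd0) (by omega) hN1 (scale_pos d hN1)
        (by rw [Nat.sub_add_cancel (by omega : 1 ≤ d)]; exact hpow) hW hB
      refine (lintegral_mono fun u => ?_).trans (hmain.trans (self_le_add_right _ _))
      refine inf_le_right.trans (le_of_eq ?_)
      refine iInf_congr fun y => iInf_congr fun _ => ?_
      rw [weight_mkTuple hd0, hfirst]
      congr 2
      refine Finset.sum_congr rfl fun k _ => ?_
      simp [updateFinset, e, entry_mem_rowEntries]
    · calc _ ≤ ∫⁻ _u : (e : rowEntries d i) → ℝ, ENNReal.ofReal d ∂cube (rowEntries d i) :=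
            lintegral_mono fun u => inf_le_left
        _ = ENNReal.ofReal d := by simp
        _ ≤ boxBound hd0 N a := by
            rw [boxBound, Set.indicator_of_mem (by exact hW)]
            exact self_le_add_left _ _
  · have hmem : ∀ u : (e : rowEntries d i) → ℝ,
        updateFinset a (rowEntries d i) u ∉ reachSet i.val B := fun u h =>
      hreach (mem_reachSet_congr hd0 i B (fun e he => hoff u e he) h)
    simp only [Set.indicator_of_notMem (hmem _), lintegral_zero, le_refl]

/-- A step with `N` unused values costs `O(N ^ (1 / d - 1))` in expectation, as long as
`n ≤ N ^ (d + 1)`. -/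
lemma exists_lintegral_stepCost_le (hd : 3 ≤ d) :
    ∃ C : ℝ, 0 < C ∧ ∀ (n : ℕ) (i : Fin n) (N : ℕ), N + i.val = n → n ≤ N ^ (d + 1) →
      ∫⁻ a, stepCost i a ∂cube (TableIndex d n) ≤ ENNReal.ofReal (C * scale d N) := by
  have hd0 : 0 < d := by omega
  obtain ⟨N₀, hN₀, hent⟩ := exists_entropy_bound (r := d - 1) (by omega)
  have hC0 := boxConst_pos (d - 1)
  refine ⟨boxConst (d - 1) + d * N₀, by positivity, fun n i N hN hn => ?_⟩
  have hN1 : 1 ≤ N := by have := i.isLt; omega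
  have hn1 : 1 ≤ n := by have := i.isLt; omega
  have hs := scale_pos d hN1
  have hs1 : scale d N ≤ 1 := by
    refine Real.rpow_le_one_of_one_le_of_nonpos (by exact_mod_cast hN1) ?_
    rw [sub_nonpos, div_le_one (by positivity)]
    exact_mod_cast hd0
  have hprob : (cube (TableIndex d n)).real
      {a | ¬ WellSpread N (scale d N) fun y => a (firstEntry hd0 y)} ≤ N₀ * scale d N := by
    have h1 := one_div_le_scale d hN1
    have hN0R : (0 : ℝ) < N := by exact_mod_cast hN1
    rcases le_or_gt N₀ N with hle | hlt
    · have h2 := cube_real_not_wellSpread_le N hs.le hs1 (firstEntry_injective (n := n) hd0)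
      have h3 := hent N hle n hn1 (by
        rwa [show d - 1 + 2 = d + 1 by omega])
      rw [card_rest hd0, Fintype.card_fin] at h2
      rw [show d - 1 + 1 = d by omega] at h3
      have h4 : (1 : ℝ) ≤ N₀ := by exact_mod_cast hN₀
      calc _ ≤ _ := h2
        _ ≤ _ := h3
        _ ≤ scale d N := h1
        _ ≤ _ := le_mul_of_one_le_left hs.le h4
    · refine measureReal_le_one.trans ?_
      have h2 : (N : ℝ) ≤ N₀ := by exact_mod_cast hlt.le
      calc (1 : ℝ) = N * (1 / N) := by field_simp
        _ ≤ N₀ * scale d N := by gcongr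
  calc ∫⁻ a, stepCost i a ∂cube (TableIndex d n)
      = ∑ B : Rest d → Finset (Fin n),
          ∫⁻ a, (reachSet i.val B).indicator (boxMin i B) a ∂cube (TableIndex d n) :=
        lintegral_finsetSum _ fun B _ =>
          (measurable_boxMin i B).indicator (measurableSet_reachSet _ _)
    _ ≤ ∑ B : Rest d → Finset (Fin n),
          ∫⁻ a, (reachSet i.val B).indicator (boxBound hd0 N) a ∂cube (TableIndex d n) :=
        Finset.sum_le_sum fun B _ => lintegral_indicator_boxMin_le hd i hN B
    _ = ∫⁻ a, ∑ B : Rest d → Finset (Fin n),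
          (reachSet i.val B).indicator (boxBound hd0 N) a ∂cube (TableIndex d n) :=
        (lintegral_finsetSum _ fun B _ =>
          (measurable_boxBound hd0 N).indicator (measurableSet_reachSet _ _)).symm
    _ ≤ ∫⁻ a, boxBound hd0 N a ∂cube (TableIndex d n) := by
        refine lintegral_mono_ae ?_
        filter_upwards [ae_sum_reachSet_le (n := n) (by omega : 2 ≤ d) i.val] with a ha
        calc _ = (∑ B : Rest d → Finset (Fin n),
              (reachSet i.val B).indicator (1 : (TableIndex d n → ℝ) → ENNReal) a) *
                boxBound hd0 N a := by
              classical
              rw [Finset.sum_mul]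
              refine Finset.sum_congr rfl fun B _ => ?_
              simp only [Set.indicator_apply, Pi.one_apply]
              split_ifs <;> simp
          _ ≤ 1 * boxBound hd0 N a := by gcongr
          _ = _ := one_mul _
    _ = ENNReal.ofReal (boxConst (d - 1) * scale d N) + ENNReal.ofReal d *
          ENNReal.ofReal ((cube (TableIndex d n)).real
            {a | ¬ WellSpread N (scale d N) fun y => a (firstEntry hd0 y)}) := by
        simp only [boxBound]
        rw [lintegral_add_left measurable_const, lintegral_const, measure_univ, mul_one,
          lintegral_indicator_const (measurableSet_not_wellSpread hd0 N _), ofReal_measureReal]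
    _ ≤ ENNReal.ofReal (boxConst (d - 1) * scale d N) + ENNReal.ofReal d *
          ENNReal.ofReal (N₀ * scale d N) := by gcongr
    _ = _ := by
        rw [← ENNReal.ofReal_mul (by positivity), ← ENNReal.ofReal_add (by positivity)
          (by positivity)]
        congr 1; ring

end Step

/-! ### The lower bound for the optimal cost -/

section Lower

variable {d n : ℕ}

/-- The entries contributing to the cost of an assignment. -/
def assignmentEntries (σ : Assignment d n) : Finset (TableIndex d n) :=
  Finset.univ.image fun p : Fin n × Fin d => entry p.2 (σ.tuple p.1)

lemma tuple_apply_injective (σ : Assignment d n) (k : Fin d) :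
    Function.Injective fun i => σ.tuple i k := by
  intro i i' h
  by_cases hk : k.val = 0
  · simpa only [Assignment.tuple, mkTuple_of_eq hk] using h
  · have h' : σ ⟨k, hk⟩ i = σ ⟨k, hk⟩ i' :=
      (mkTuple_rest i (fun k => σ k i) ⟨k, hk⟩).symm.trans
        (h.trans (mkTuple_rest i' (fun k => σ k i') ⟨k, hk⟩))
    exact (σ ⟨k, hk⟩).injective h'

lemma entry_tuple_injective (hd : 2 ≤ d) (σ : Assignment d n) :
    Function.Injective fun p : Fin n × Fin d => entry p.2 (σ.tuple p.1) := by
  rintro ⟨i, j⟩ ⟨i', j'⟩ h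
  obtain ⟨rfl, h⟩ := entry_eq_iff.1 h
  have : Nontrivial (Fin d) := Fin.nontrivial_iff_two_le.2 hd
  obtain ⟨k, hk⟩ := exists_ne j
  exact Prod.ext (tuple_apply_injective σ k (h k hk)) rfl

lemma card_assignmentEntries (hd : 2 ≤ d) (σ : Assignment d n) :
    (assignmentEntries σ).card = n * d := by
  rw [assignmentEntries, Finset.card_image_of_injective _ (entry_tuple_injective hd σ)]
  simp

lemma cost_eq_sum (hd : 2 ≤ d) (a : TableIndex d n → ℝ) (σ : Assignment d n) :
    cost (weight a) σ = ∑ e ∈ assignmentEntries σ, a e := by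
  rw [assignmentEntries, Finset.sum_image fun _ _ _ _ h => entry_tuple_injective hd σ h,
    Fintype.sum_prod_type]
  rfl

lemma card_assignment_le (hd : 0 < d) :
    Fintype.card (Assignment d n) ≤ (n ^ n) ^ (d - 1) := by
  rw [Fintype.card_fun, card_rest hd, Fintype.card_perm, Fintype.card_fin]
  exact Nat.pow_le_pow_left (Nat.factorial_le_pow n) _

/-- A union bound over all assignments. -/
lemma cube_real_optCost_le (hd : 2 ≤ d) (hn : 1 ≤ n) :
    (cube (TableIndex d n)).real
      {a | optCost (weight a) ≤ d / (2 * Real.exp 1) * (n : ℝ) ^ (1 / (d : ℝ))} ≤ 1 / 2 := by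
  have hd0 : (0 : ℝ) < d := by exact_mod_cast (by omega : 0 < d)
  have hn0 : (0 : ℝ) < n := by exact_mod_cast hn
  set z : ℝ := (n : ℝ) ^ (1 / (d : ℝ)) with hz
  have hz0 : 0 < z := Real.rpow_pos_of_pos hn0 _
  have hzd : z ^ d = n := by
    rw [hz, ← Real.rpow_natCast, ← Real.rpow_mul hn0.le, one_div_mul_cancel hd0.ne', Real.rpow_one]
  set s : ℝ := d / (2 * Real.exp 1) * z with hs
  have hs0 : 0 < s := by positivity
  have hsub : {a : TableIndex d n → ℝ | optCost (weight a) ≤ s} ⊆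
      ⋃ σ ∈ (Finset.univ : Finset (Assignment d n)), {a | ∑ e ∈ assignmentEntries σ, a e ≤ s} := by
    intro a ha
    obtain ⟨σ, hσ⟩ := exists_eq_ciInf_of_finite (f := fun σ : Assignment d n => cost (weight a) σ)
    refine Set.mem_biUnion (x := σ) (Finset.mem_univ σ) ?_
    simp only [Set.mem_ofPred_eq]
    rw [← cost_eq_sum hd]
    exact hσ.le.trans ha
  refine (measureReal_mono hsub (measure_ne_top _ _)).trans
    ((measureReal_biUnion_finset_le _ _).trans ?_)
  have hσ : ∀ σ ∈ (Finset.univ : Finset (Assignment d n)),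
      (cube (TableIndex d n)).real {a | ∑ e ∈ assignmentEntries σ, a e ≤ s} ≤
        (z / (2 * n)) ^ (n * d) := by
    intro σ _
    have hc := card_assignmentEntries hd σ
    have hne : (assignmentEntries σ).Nonempty := by
      rw [← Finset.card_pos, hc]; exact Nat.mul_pos hn (by omega)
    refine (cube_real_sum_le _ hne hs0).trans (le_of_eq ?_)
    rw [hc, hs]
    congr 1
    push_cast
    field_simp
  refine (Finset.sum_le_card_nsmul _ _ _ hσ).trans ?_
  rw [nsmul_eq_mul, Finset.card_univ]
  have h1 : (z / (2 * n)) ^ (n * d) = (1 / 2 : ℝ) ^ (n * d) * ((n : ℝ) ^ n / (n ^ n) ^ d) := by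
    rw [show z / (2 * n) = 1 / 2 * (z / n) by field_simp, mul_pow, div_pow z, mul_comm n d,
      pow_mul z, hzd, ← pow_mul (n : ℝ) n d, mul_comm n d]
  calc _ ≤ ((n : ℝ) ^ n) ^ (d - 1) * (z / (2 * n)) ^ (n * d) := by
        gcongr
        exact_mod_cast card_assignment_le (by omega)
    _ = (1 / 2 : ℝ) ^ (n * d) := by
        rw [h1]
        obtain ⟨q, rfl⟩ : ∃ q, d = q + 1 := ⟨d - 1, by omega⟩
        rw [Nat.add_sub_cancel, pow_succ ((n : ℝ) ^ n) q]
        field_simp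
    _ ≤ (1 / 2 : ℝ) ^ 1 := pow_le_pow_of_le_one (by norm_num) (by norm_num)
        (Nat.mul_pos hn (by omega))
    _ = 1 / 2 := pow_one _

lemma cost_mem_Icc {a : TableIndex d n → ℝ} (ha : ∀ e, a e ∈ Set.Icc (0 : ℝ) 1)
    (σ : Assignment d n) : cost (weight a) σ ∈ Set.Icc (0 : ℝ) (n * d) := by
  refine ⟨Finset.sum_nonneg fun _ _ => weight_nonneg ha _, ?_⟩
  have := Finset.sum_le_card_nsmul Finset.univ (fun i => weight a (σ.tuple i)) (d : ℝ)
    fun i _ => weight_le ha _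
  simpa [cost] using this

lemma measurable_cost (σ : Assignment d n) :
    Measurable fun a : TableIndex d n → ℝ => cost (weight a) σ :=
  Finset.measurable_sum _ fun _ _ => measurable_weight _

lemma measurable_optCost : Measurable fun a : TableIndex d n → ℝ => optCost (weight a) :=
  Measurable.iInf fun σ => measurable_cost σ

lemma optCost_mem_Icc {a : TableIndex d n → ℝ} (ha : ∀ e, a e ∈ Set.Icc (0 : ℝ) 1) :
    optCost (weight a) ∈ Set.Icc (0 : ℝ) (n * d) := by
  obtain ⟨σ, hσ⟩ := exists_eq_ciInf_of_finite (f := fun σ : Assignment d n => cost (weight a) σ)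
  rw [optCost, ← hσ]
  exact cost_mem_Icc ha σ

lemma integrable_optCost :
    Integrable (fun a : TableIndex d n → ℝ => optCost (weight a)) (cube (TableIndex d n)) := by
  refine Integrable.of_bound measurable_optCost.aestronglyMeasurable (n * d) ?_
  filter_upwards [ae_mem_Icc_cube] with a ha
  rw [Real.norm_of_nonneg (optCost_mem_Icc ha).1]
  exact (optCost_mem_Icc ha).2

lemma le_integral_optCost (hd : 2 ≤ d) (hn : 1 ≤ n) :
    d / (4 * Real.exp 1) * (n : ℝ) ^ (1 / (d : ℝ)) ≤
      ∫ a, optCost (weight a) ∂cube (TableIndex d n) := by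
  set s : ℝ := d / (2 * Real.exp 1) * (n : ℝ) ^ (1 / (d : ℝ)) with hs
  have hs0 : 0 ≤ s := by positivity
  have hm := mul_meas_ge_le_integral_of_nonneg (μ := cube (TableIndex d n))
    (f := fun a => optCost (weight a))
    (by filter_upwards [ae_mem_Icc_cube] with a ha using (optCost_mem_Icc ha).1)
    integrable_optCost s
  have hset : MeasurableSet {a : TableIndex d n → ℝ | optCost (weight a) ≤ s} :=
    measurableSet_le measurable_optCost measurable_const
  have h1 : 1 / 2 ≤ (cube (TableIndex d n)).real {a | s ≤ optCost (weight a)} := by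
    have h2 := probReal_compl_eq_one_sub (μ := cube (TableIndex d n)) hset
    have h3 := cube_real_optCost_le hd hn
    have h4 : (cube (TableIndex d n)).real {a | optCost (weight a) ≤ s}ᶜ ≤
        (cube (TableIndex d n)).real {a | s ≤ optCost (weight a)} :=
      measureReal_mono (fun a ha => le_of_lt
        (lt_of_not_ge (id ha : ¬ optCost (weight a) ≤ s))) (measure_ne_top _ _)
    linarith
  calc _ = s * (1 / 2) := by rw [hs]; ring
    _ ≤ s * (cube (TableIndex d n)).real {a | s ≤ optCost (weight a)} := by gcongr
    _ ≤ _ := hm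

end Lower

/-! ### The upper bound for the greedy algorithm -/

/-- The expected cost of an output of the algorithm, for any rule for ties and completion. -/
lemma exists_lintegral_greedy_le {d : ℕ} (hd : 3 ≤ d) :
    ∃ C : ℝ, 0 < C ∧ ∀ n : ℕ, 1 ≤ n → ∀ m : ℕ,
      |((n : ℝ) - (m : ℝ)) - (n : ℝ) ^ (1 / ((d : ℝ) + 1))| < 1 → m ≤ n ∧
      ∫⁻ a, ∑ i : Fin n, (if i.val < m then stepCost i a else ENNReal.ofReal d)
        ∂cube (TableIndex d n) ≤ ENNReal.ofReal (C * (n : ℝ) ^ (1 / (d : ℝ))) := by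
  obtain ⟨C, hC, hstep⟩ := exists_lintegral_stepCost_le hd
  have hd0 : (0 : ℝ) < d := by exact_mod_cast (by omega : 0 < d)
  refine ⟨C * d + 2 * d, by positivity, fun n hn m hm => ?_⟩
  obtain ⟨hlo, hhi⟩ := abs_lt.1 hm
  have hn1 : (1 : ℝ) ≤ n := by exact_mod_cast hn
  set z : ℝ := (n : ℝ) ^ (1 / ((d : ℝ) + 1)) with hz
  have hz1 : 1 ≤ z := Real.one_le_rpow hn1 (by positivity)
  have hzd : z ^ (d + 1) = n := by
    rw [hz, ← Real.rpow_natCast, ← Real.rpow_mul (by linarith)]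
    push_cast
    rw [one_div_mul_cancel (by positivity), Real.rpow_one]
  have hzn : z ≤ (n : ℝ) ^ (1 / (d : ℝ)) := by
    refine Real.rpow_le_rpow_of_exponent_le hn1 ?_
    gcongr
    linarith
  have hmn : m ≤ n := by
    have : (m : ℝ) < n := by linarith
    exact_mod_cast this.le
  refine ⟨hmn, ?_⟩
  have hmeas : ∀ i : Fin n, Measurable fun a : TableIndex d n → ℝ =>
      if i.val < m then stepCost i a else ENNReal.ofReal d := by
    intro i
    split_ifs
    · exact measurable_stepCost i
    · exact measurable_const
  rw [lintegral_finsetSum _ fun i _ => hmeas i]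
  have hterm : ∀ i : Fin n,
      ∫⁻ a, (if i.val < m then stepCost i a else ENNReal.ofReal d) ∂cube (TableIndex d n) ≤
        ENNReal.ofReal (C * scale d (n - i.val) + if i.val < m then 0 else (d : ℝ)) := by
    intro i
    have hi := i.isLt
    have hpos := scale_pos d (N := n - i.val) (by omega)
    split_ifs with him
    · rw [add_zero]
      refine hstep n i (n - i.val) (by omega) ?_
      -- at least `n - m + 1 > n ^ (1 / (d + 1))` values are unused before a step
      have h1 : z ≤ ((n - i.val : ℕ) : ℝ) := by
        rw [Nat.cast_sub hi.le]
        have : (i.val : ℝ) + 1 ≤ m := by exact_mod_cast him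
        linarith
      have h2 : (n : ℝ) ≤ ((n - i.val : ℕ) : ℝ) ^ (d + 1) := by
        rw [← hzd]; gcongr
      exact_mod_cast h2
    · rw [lintegral_const, measure_univ, mul_one]
      refine ENNReal.ofReal_le_ofReal ?_
      have : 0 < C * scale d (n - i.val) := by positivity
      linarith
  refine (Finset.sum_le_sum fun i _ => hterm i).trans ?_
  have hnn : ∀ i : Fin n, 0 ≤ C * scale d (n - i.val) + if i.val < m then 0 else (d : ℝ) := by
    intro i
    have hpos := scale_pos d (N := n - i.val) (by have := i.isLt; omega)
    split_ifs <;> positivity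
  rw [← ENNReal.ofReal_sum_of_nonneg fun i _ => hnn i]
  refine ENNReal.ofReal_le_ofReal ?_
  rw [Finset.sum_add_distrib, ← Finset.mul_sum]
  have hs1 : ∑ i : Fin n, scale d (n - i.val) ≤ d * (n : ℝ) ^ (1 / (d : ℝ)) := by
    rw [Fin.sum_univ_eq_sum_range fun i => scale d (n - i), ← Finset.sum_range_reflect]
    refine le_trans (le_of_eq (Finset.sum_congr rfl fun i hi => ?_)) (sum_scale_le (by omega) n)
    have := Finset.mem_range.1 hi
    congr 1; omega
  have hs2 : ∑ i : Fin n, (if i.val < m then 0 else (d : ℝ)) ≤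
      2 * d * (n : ℝ) ^ (1 / (d : ℝ)) := by
    have hcard : (Finset.univ.filter fun i : Fin n => ¬ i.val < m).card = n - m := by
      have h1 := Finset.card_filter_add_card_filter_not (s := (Finset.univ : Finset (Fin n)))
        (fun i : Fin n => i.val < m)
      have h2 : (Finset.univ.filter fun i : Fin n => i.val < m).card = m := by
        rw [Fin.card_filter_val_lt]; omega
      rw [Finset.card_univ, Fintype.card_fin] at h1
      omega
    calc ∑ i : Fin n, (if i.val < m then 0 else (d : ℝ))
        = ∑ i : Fin n, (if ¬ i.val < m then (d : ℝ) else 0) :=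
          Finset.sum_congr rfl fun i _ => by rw [ite_not]
      _ = ((n : ℝ) - m) * d := by
          rw [← Finset.sum_filter, Finset.sum_const, hcard, nsmul_eq_mul, Nat.cast_sub hmn]
      _ ≤ (2 * (n : ℝ) ^ (1 / (d : ℝ))) * d := by gcongr; linarith
      _ = _ := by ring
  have := mul_le_mul_of_nonneg_left hs1 hC.le
  linarith

end MultiAssign

theorem mainTheorem3 (d : ℕ) (hd : 3 ≤ d) :
    ∃ c C : ℝ, 0 < c ∧ 0 < C ∧
      ∀ (n : ℕ) (_ : 1 ≤ n) (Ω : Type*) [MeasurableSpace Ω] (P : Measure Ω)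
        [IsProbabilityMeasure P] (A : MultiAssign.TableIndex d n → Ω → ℝ)
        (_ : MultiAssign.IsUniformModel P A),
        (Integrable (fun ω => MultiAssign.optCost (MultiAssign.weight (fun e => A e ω))) P ∧
          c * (n : ℝ) ^ (1 / (d : ℝ)) ≤
            ∫ ω, MultiAssign.optCost (MultiAssign.weight (fun e => A e ω)) ∂P) ∧
        ∀ m : ℕ, |((n : ℝ) - (m : ℝ)) - (n : ℝ) ^ (1 / ((d : ℝ) + 1))| < 1 →
          (∀ ω, ∃ σ, MultiAssign.IsGreedyOutput (MultiAssign.weight (fun e => A e ω)) m σ) ∧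
          ∀ σ : Ω → MultiAssign.Assignment d n,
            AEMeasurable
              (fun ω => MultiAssign.cost (MultiAssign.weight (fun e => A e ω)) (σ ω)) P →
            (∀ᵐ ω ∂P,
              MultiAssign.IsGreedyOutput (MultiAssign.weight (fun e => A e ω)) m (σ ω)) →
            Integrable
              (fun ω => MultiAssign.cost (MultiAssign.weight (fun e => A e ω)) (σ ω)) P ∧
            ∫ ω, MultiAssign.cost (MultiAssign.weight (fun e => A e ω)) (σ ω) ∂P ≤
              C * (n : ℝ) ^ (1 / (d : ℝ)) := by
  obtain ⟨C, hC, hgreedy⟩ := MultiAssign.exists_lintegral_greedy_le hd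
  have hd0 : (0 : ℝ) < d := by exact_mod_cast (by omega : 0 < d)
  refine ⟨d / (4 * Real.exp 1), C, by positivity, hC, ?_⟩
  intro n hn Ω _ P _ A hA
  have hlaw : HasLaw (fun ω e => A e ω) (MultiAssign.cube (MultiAssign.TableIndex d n)) P :=
    hA.indep.hasLaw_pi hA.uniform
  have hIcc : ∀ᵐ ω ∂P, ∀ e, A e ω ∈ Set.Icc (0 : ℝ) 1 := by
    refine ae_of_ae_map (p := fun a => ∀ e, a e ∈ Set.Icc (0 : ℝ) 1) hlaw.aemeasurable ?_
    rw [hlaw.map_eq]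
    exact MultiAssign.ae_mem_Icc_cube
  refine ⟨⟨?_, ?_⟩, fun m hm => ?_⟩
  · have h := MultiAssign.integrable_optCost (d := d) (n := n)
    rw [← hlaw.map_eq] at h
    exact h.comp_aemeasurable hlaw.aemeasurable
  · have h := hlaw.integral_comp (f := fun a => MultiAssign.optCost (MultiAssign.weight a))
      MultiAssign.measurable_optCost.aestronglyMeasurable
    exact (MultiAssign.le_integral_optCost (by omega) hn).trans h.symm.le
  · obtain ⟨hmn, hle⟩ := hgreedy n hn m hm
    refine ⟨fun ω => MultiAssign.exists_isGreedyOutput _ hmn, fun σ hσ hout => ?_⟩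
    have hint : Integrable
        (fun ω => MultiAssign.cost (MultiAssign.weight (fun e => A e ω)) (σ ω)) P := by
      refine Integrable.of_bound hσ.aestronglyMeasurable (n * d) ?_
      filter_upwards [hIcc] with ω hω
      rw [Real.norm_of_nonneg (MultiAssign.cost_mem_Icc hω _).1]
      exact (MultiAssign.cost_mem_Icc hω _).2
    refine ⟨hint, ?_⟩
    have hnn : 0 ≤ᵐ[P] fun ω => MultiAssign.cost (MultiAssign.weight (fun e => A e ω)) (σ ω) := by
      filter_upwards [hIcc] with ω hω using (MultiAssign.cost_mem_Icc hω _).1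
    rw [← ENNReal.ofReal_le_ofReal_iff (by positivity),
      ofReal_integral_eq_lintegral_ofReal hint hnn]
    refine le_trans ?_ hle
    have hmeas : Measurable fun a : MultiAssign.TableIndex d n → ℝ =>
        ∑ i : Fin n, (if i.val < m then MultiAssign.stepCost i a else ENNReal.ofReal d) := by
      refine Finset.measurable_sum _ fun i _ => ?_
      split_ifs
      · exact MultiAssign.measurable_stepCost i
      · exact measurable_const
    rw [← hlaw.lintegral_comp hmeas.aemeasurable]
    refine lintegral_mono_ae ?_
    filter_upwards [hIcc, hout] with ω hω hω'
    exact MultiAssign.cost_le_of_isGreedyOutput (by omega) hω hω'
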